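/- **Conventions (continuous logic).** A metric language $\mathcal L$ consists of a set of sorts $S$, each with a metric symbol $d_S$ and a bound $B_S>0$; function symbols $f$, each with a finite (possibly empty) product of sorts as domain, a sort as codomain and a uniform continuity modulus $\delta_f$; and relation symbols $R$, each with a finite product of sorts as domain, a bound $B_R>0$ and a modulus $\delta_R$. A modulus is an increasing continuous $\delta:[0,1]\to[0,1]$ with $\delta(\epsilon)>0$ for $\epsilon>0$ and $\lim_{\epsilon\to0^+}\delta(\epsilon)=0$. An $\mathcal L$-structure $\mathcal M$ interprets each $S$ as a non-empty complete metric space of diameter at most $B_S$, each $f$ as a function and each $R$ as a function into $[-B_R,B_R]$, such that, for all $\epsilon\in(0,1]$, arguments that are coordinatewise at distance $<\delta(\epsilon)$ have values at distance $\le\epsilon$. Basic formulas are built from the atomic formulas $d_S(\tau_1,\tau_2)$, $R(\bar\tau)$ (with $\tau_i$ terms) using all continuous functions $\mathbb R^k\to\mathbb R$ as connectives and the quantifiers $\sup_x,\inf_x$ over sorts. A theory $T$ is a set of basic sentences; $\mathcal M\models T$ means $\sigma^{\mathcal M}=0$ for all $\sigma\in T$. A $T$-formula in the variables $\bar x$ is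 an element of the completion of the set of basic formulas $\varphi(\bar x)$ under the seminorm $\|\varphi\|_T=\sup\{|\varphi^{\mathcal M}(\bar a)|:\mathcal M\models T,\ \bar a\in\mathcal M\}$; if $\varphi=\lim_n\varphi_n$ then $\varphi^{\mathcal M}(\bar a)=\lim_n\varphi_n^{\mathcal M}(\bar a)$. $\mathrm{Mod}(T)$ is the category of models of $T$ with elementary embeddings. For a tuple of sorts $\bar S=(S_1,\dots,S_n)$, $n\ge1$, the product $\bar S(\mathcal M)$ carries the maximum metric. A *$T$-functor* $X$ for $\bar S$ assigns to each model $\mathcal M$ of $T$ a closed (possibly empty) subspace $X(\mathcal M)\subseteq\bar S(\mathcal M)$ such that every elementary embedding $\rho:\mathcal M\to\mathcal N$ of models of $T$ maps $X(\mathcal M)$ into $X(\mathcal N)$ (and $X(\rho)$ is the restriction of $\rho$). *Empty sets.* $d(\bar a,\emptyset)$ is the upper bound $\max_jB_{S_j}$ on the metric of $\bar S$. For a $T$-formula $\psi$, the infimum of $\psi$ over $\emptyset$ is the maximum possible value $\sup\{\psi^{\mathcal M}(\bar b,\bar a):\mathcal M\models T,\ \bar b,\bar a\in\mathcal M\}$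 of $\psi$, and its supremum over $\emptyset$ is the minimum possible value, $\inf$ of the same set. *Ultraproducts.* For an ultrafilter $\mathcal U$ on a set $I$, $\prod_{\mathcal U}\mathcal M_i$ is the metric ultraproduct: on each sort, the quotient of $\prod_iS^{\mathcal M_i}$ by the pseudometric $\lim_{\mathcal U}d_i$, with function symbols interpreted coordinatewise and relation symbols by $\lim_{\mathcal U}R^{\mathcal M_i}$. For $A_i\subseteq\bar S(\mathcal M_i)$, $\prod_{\mathcal U}A_i\subseteq\bar S(\prod_{\mathcal U}\mathcal M_i)$ is the set of classes $[(\bar a_i)]_{\mathcal U}$ with $\bar a_i\in A_i$ for $\mathcal U$-almost all $i$ (equivalently, if all $A_i$ are non-empty, for all $i$). **Theorem.** Let $T$ be an $\mathcal L$-theory, $\bar S$ a non-empty finite tuple of sorts and $X$ a $T$-functor for $\bar S$. The following are equivalent. 1. There is a $T$-formula $\varphi(\bar x)$ such that $\varphi^{\mathcal M}(\bar a)=d(\bar a,X(\mathcal M))$ for every model $\mathcal M$ of $T$ and every $\bar a\in\bar S(\mathcal M)$. 2. For every $T$-formula $\psi(\bar x,\bar y)$ ($\bar x$ of sort $\bar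 S$, $\bar y$ any finite tuple of variables) there is a $T$-formula $\chi(\bar y)$ such that, for every model $\mathcal M$ of $T$ and every $\bar a\in\mathcal M$ of the sort of $\bar y$, $\chi^{\mathcal M}(\bar a)=\inf\{\psi^{\mathcal M}(\bar b,\bar a):\bar b\in X(\mathcal M)\}$. (2$'$) The same statement with $\sup$ in place of $\inf$. 3. For every $\epsilon>0$ there are a $T$-formula $\varphi(\bar x)$ and $\delta>0$ such that, for every model $\mathcal M$ of $T$: $\varphi^{\mathcal M}=0$ on $X(\mathcal M)$, and for all $\bar a\in\bar S(\mathcal M)$, if $\varphi^{\mathcal M}(\bar a)<\delta$ then $d(\bar a,X(\mathcal M))\le\epsilon$. 4. The same as 3, with a basic $\mathcal L$-formula $\varphi(\bar x)$ in place of a $T$-formula. 5. For every set $I$, every family $(\mathcal M_i)_{i\in I}$ of models of $T$ and every ultrafilter $\mathcal U$ on $I$, $X(\prod_{\mathcal U}\mathcal M_i)=\prod_{\mathcal U}X(\mathcal M_i)$. -/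

import Mathlib

open Filter Topology

universe u

namespace ContinuousLogic

/-! ### Languages and structures -/

/-- A uniform continuity modulus: an increasing continuous function `δ : [0,1] → [0,1]` with
`δ(ε) → 0` as `ε → 0+`.  "Increasing" is taken in the weak sense together with `δ(ε) > 0` for
`ε > 0`; a strictly increasing `δ` satisfies both. -/
structure Modulus where
  toFun : unitInterval → unitInterval
  continuous' : Continuous toFun
  monotone' : Monotone toFun
  pos' : ∀ ε, 0 < ε → 0 < toFun ε
  tendsto_zero' : Tendsto toFun (𝓝[>] 0) (𝓝 0)

/-- `δ` witnesses the uniform continuity of `f : A₁ × ⋯ × Aₖ → B`. -/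
def Modulus.Witnesses (δ : Modulus) {k : ℕ} {A : Fin k → Type u} [∀ j, MetricSpace (A j)]
    {B : Type*} [PseudoMetricSpace B] (f : (∀ j, A j) → B) : Prop :=
  ∀ ε : unitInterval, 0 < ε → ∀ a b : ∀ j, A j,
    (∀ j, dist (a j) (b j) < (δ.toFun ε : ℝ)) → dist (f a) (f b) ≤ (ε : ℝ)

/-- A (many-sorted) metric language.  The metric symbol `d_S` of each sort `S` is built in; `bound S`
is its bound.  Constants are function symbols of arity `0`. -/
structure MetricLanguage where
  Sorts : Type u
  bound : Sorts → ℝ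
  bound_pos : ∀ S, 0 < bound S
  Func : Type u
  funcArity : Func → ℕ
  funcDom : ∀ f, Fin (funcArity f) → Sorts
  funcCod : Func → Sorts
  funcModulus : Func → Modulus
  Rel : Type u
  relArity : Rel → ℕ
  relDom : ∀ R, Fin (relArity R) → Sorts
  relBound : Rel → ℝ
  relBound_pos : ∀ R, 0 < relBound R
  relModulus : Rel → Modulus

/-- A metric structure for the language `L`: every sort is a non-empty complete metric space of
diameter at most `L.bound S`, and the symbols obey their bounds and moduli. -/
structure MetricStructure (L : MetricLanguage.{u}) where
  carrier : L.Sorts → Type u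
  [metric : ∀ S, MetricSpace (carrier S)]
  [complete : ∀ S, CompleteSpace (carrier S)]
  [nonempty : ∀ S, Nonempty (carrier S)]
  dist_le : ∀ S (a b : carrier S), dist a b ≤ L.bound S
  func : ∀ f : L.Func, (∀ j, carrier (L.funcDom f j)) → carrier (L.funcCod f)
  func_modulus : ∀ f, (L.funcModulus f).Witnesses (func f)
  rel : ∀ R : L.Rel, (∀ j, carrier (L.relDom R j)) → ℝ
  rel_le : ∀ R a, |rel R a| ≤ L.relBound R
  rel_modulus : ∀ R, (L.relModulus R).Witnesses (rel R)

attribute [instance] MetricStructure.metric MetricStructure.complete MetricStructure.nonempty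

/-- `M.Tuple Γ` is the product `Γ(M)` of the sorts listed by `Γ`.  For `Γ` indexed by `Fin n` it
carries the maximum metric. -/
abbrev MetricStructure.Tuple {L : MetricLanguage.{u}} (M : MetricStructure L) {α : Type}
    (Γ : α → L.Sorts) : Type u :=
  ∀ a, M.carrier (Γ a)

/-- Concatenation `(b̄, ā)` of two tuples. -/
def MetricStructure.Tuple.append {L : MetricLanguage.{u}} {M : MetricStructure L} {α β : Type}
    {Γ : α → L.Sorts} {Δ : β → L.Sorts} (b : M.Tuple Γ) (a : M.Tuple Δ) :
    M.Tuple (Sum.elim Γ Δ) :=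
  fun k => match k with
    | .inl i => b i
    | .inr j => a j

/-! ### Terms and basic formulas -/

section Formulas

variable {L : MetricLanguage.{u}} {α : Type} {Γ : α → L.Sorts}

/-- Terms whose free variables are listed by `Γ` and whose bound variables are listed by `Δ`. -/
inductive Term (L : MetricLanguage.{u}) {α : Type} (Γ : α → L.Sorts) {n : ℕ}
    (Δ : Fin n → L.Sorts) : L.Sorts → Type u
  | free (i : α) : Term L Γ Δ (Γ i)
  | bound (j : Fin n) : Term L Γ Δ (Δ j)
  | app (f : L.Func) (t : ∀ j, Term L Γ Δ (L.funcDom f j)) : Term L Γ Δ (L.funcCod f)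

/-- Interpretation of a term in a structure. -/
def Term.eval (M : MetricStructure L) {n : ℕ} {Δ : Fin n → L.Sorts} (v : M.Tuple Γ)
    (w : M.Tuple Δ) : ∀ {S : L.Sorts}, Term L Γ Δ S → M.carrier S
  | _, .free i => v i
  | _, .bound j => w j
  | _, .app f t => M.func f fun j => (t j).eval M v w

/-- Basic formulas with free variables among those listed by `Γ`, and with (de Bruijn) variables
listed by `Δ` that are waiting to be quantified; a quantifier binds the variable with index `0`. -/
inductive PreFormula (L : MetricLanguage.{u}) {α : Type} (Γ : α → L.Sorts) :
    (n : ℕ) → (Fin n → L.Sorts) → Type u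
  | dist {n : ℕ} {Δ : Fin n → L.Sorts} {S : L.Sorts} (t₁ t₂ : Term L Γ Δ S) : PreFormula L Γ n Δ
  | rel {n : ℕ} {Δ : Fin n → L.Sorts} (R : L.Rel) (t : ∀ j, Term L Γ Δ (L.relDom R j)) :
      PreFormula L Γ n Δ
  | conn {n : ℕ} {Δ : Fin n → L.Sorts} {k : ℕ} (f : C(Fin k → ℝ, ℝ))
      (φ : Fin k → PreFormula L Γ n Δ) : PreFormula L Γ n Δ
  | sup {n : ℕ} {Δ : Fin n → L.Sorts} (S : L.Sorts)
      (φ : PreFormula L Γ (n + 1) (Fin.cons S Δ : Fin (n + 1) → L.Sorts)) : PreFormula L Γ n Δ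
  | inf {n : ℕ} {Δ : Fin n → L.Sorts} (S : L.Sorts)
      (φ : PreFormula L Γ (n + 1) (Fin.cons S Δ : Fin (n + 1) → L.Sorts)) : PreFormula L Γ n Δ

/-- Add a value for the variable with index `0`. -/
def consTuple {M : MetricStructure L} {n : ℕ} {Δ : Fin n → L.Sorts} {S : L.Sorts}
    (b : M.carrier S) (w : M.Tuple Δ) : M.Tuple (Fin.cons S Δ : Fin (n + 1) → L.Sorts) :=
  fun j => Fin.cases (motive := fun j => M.carrier ((Fin.cons S Δ : Fin (n + 1) → L.Sorts) j)) b w j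

/-- Interpretation of basic formulas. -/
noncomputable def PreFormula.eval (M : MetricStructure L) (v : M.Tuple Γ) :
    ∀ {n : ℕ} {Δ : Fin n → L.Sorts}, PreFormula L Γ n Δ → M.Tuple Δ → ℝ
  | _, _, .dist t₁ t₂, w => Dist.dist (t₁.eval M v w) (t₂.eval M v w)
  | _, _, .rel R t, w => M.rel R fun j => (t j).eval M v w
  | _, _, .conn f φ, w => f fun j => (φ j).eval M v w
  | _, _, .sup S φ, w => ⨆ b : M.carrier S, φ.eval M v (consTuple b w)
  | _, _, .inf S φ, w => ⨅ b : M.carrier S, φ.eval M v (consTuple b w)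

/-- Basic `L`-formulas `φ(x̄)` whose free variables are among the sorted variables `x̄` listed
by `Γ`. -/
abbrev BasicFormula (L : MetricLanguage.{u}) {α : Type} (Γ : α → L.Sorts) : Type u :=
  PreFormula L Γ 0 Fin.elim0

/-- The value `φ^M(ā)`. -/
noncomputable def BasicFormula.val (φ : BasicFormula L Γ) (M : MetricStructure L)
    (a : M.Tuple Γ) : ℝ :=
  PreFormula.eval M a φ fun j => j.elim0

/-- Basic formulas are bounded, uniformly over all structures. -/
theorem PreFormula.exists_bound {n : ℕ} {Δ : Fin n → L.Sorts} (φ : PreFormula L Γ n Δ) :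
    ∃ B : ℝ, ∀ (M : MetricStructure L) (v : M.Tuple Γ) (w : M.Tuple Δ), |φ.eval M v w| ≤ B := by
  induction φ with
  | @dist n Δ S t₁ t₂ =>
    refine ⟨L.bound S, fun M v w => ?_⟩
    simpa [PreFormula.eval, abs_of_nonneg] using M.dist_le S _ _
  | rel R t => exact ⟨L.relBound R, fun M v w => M.rel_le R _⟩
  | @conn n Δ k f φ ih =>
    choose B hB using ih
    have hc : IsCompact (Set.Icc (fun j => -B j) B : Set (Fin k → ℝ)) := isCompact_Icc
    obtain ⟨C, hC⟩ := hc.exists_bound_of_continuousOn f.continuous.continuousOn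
    refine ⟨C, fun M v w => ?_⟩
    have := hC (fun j => (φ j).eval M v w)
      ⟨fun j => (abs_le.1 (hB j M v w)).1, fun j => (abs_le.1 (hB j M v w)).2⟩
    simpa [PreFormula.eval] using this
  | sup S φ ih =>
    obtain ⟨B, hB⟩ := ih
    refine ⟨B, fun M v w => abs_le.2 ⟨?_, ?_⟩⟩
    · obtain ⟨b⟩ := M.nonempty S
      exact (abs_le.1 (hB M v (consTuple b w))).1.trans
        (le_ciSup (f := fun b => φ.eval M v (consTuple b w))
          ⟨B, by rintro _ ⟨b, rfl⟩; exact (abs_le.1 (hB M v _)).2⟩ b)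
    · exact ciSup_le fun b => (abs_le.1 (hB M v _)).2
  | inf S φ ih =>
    obtain ⟨B, hB⟩ := ih
    refine ⟨B, fun M v w => abs_le.2 ⟨?_, ?_⟩⟩
    · exact le_ciInf fun b => (abs_le.1 (hB M v _)).1
    · obtain ⟨b⟩ := M.nonempty S
      exact (ciInf_le (f := fun b => φ.eval M v (consTuple b w))
          ⟨-B, by rintro _ ⟨b, rfl⟩; exact (abs_le.1 (hB M v _)).1⟩ b).trans
        (abs_le.1 (hB M v (consTuple b w))).2

/-- The basic formula `φ - ψ`. -/
def BasicFormula.sub (φ ψ : BasicFormula L Γ) : BasicFormula L Γ :=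
  .conn (k := 2) ⟨fun x => x 0 - x 1, by fun_prop⟩ ![φ, ψ]

theorem BasicFormula.val_sub (φ ψ : BasicFormula L Γ) (M : MetricStructure L) (a : M.Tuple Γ) :
    (φ.sub ψ).val M a = φ.val M a - ψ.val M a := by
  simp [BasicFormula.sub, BasicFormula.val, PreFormula.eval]

/-! ### Theories, models, elementary embeddings -/

/-- Sentences: basic formulas without free variables. -/
abbrev Sentence (L : MetricLanguage.{u}) : Type u :=
  BasicFormula L (Fin.elim0 : Fin 0 → L.Sorts)

/-- A set of sentences. -/
abbrev Theory (L : MetricLanguage.{u}) : Type u := Set (Sentence L)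

/-- `M ⊨ T`: every sentence of `T` takes the value `0` in `M`. -/
def MetricStructure.IsModel (M : MetricStructure L) (T : Theory L) : Prop :=
  ∀ σ ∈ T, BasicFormula.val σ M (fun i => i.elim0) = 0

/-- The models of `T`. -/
structure Model (T : Theory L) extends MetricStructure L where
  isModel : toMetricStructure.IsModel T

/-- An elementary embedding: an embedding that preserves the values of all formulas. -/
structure ElementaryEmbedding (M N : MetricStructure L) where
  toFun : ∀ S, M.carrier S → N.carrier S
  map_dist : ∀ S (a b : M.carrier S), dist (toFun S a) (toFun S b) = dist a b
  map_func : ∀ (f : L.Func) (a : M.Tuple (L.funcDom f)),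
    toFun _ (M.func f a) = N.func f fun j => toFun _ (a j)
  map_rel : ∀ (R : L.Rel) (a : M.Tuple (L.relDom R)),
    N.rel R (fun j => toFun _ (a j)) = M.rel R a
  map_formula : ∀ {n : ℕ} (Γ : Fin n → L.Sorts) (φ : BasicFormula L Γ) (a : M.Tuple Γ),
    φ.val N (fun i => toFun _ (a i)) = φ.val M a

/-! ### `T`-formulas -/

/-- The seminorm `‖φ‖_T = sup { |φ^M(ā)| : M ⊨ T, ā ∈ M }`. -/
noncomputable def seminorm (T : Theory L) (φ : BasicFormula L Γ) : ℝ :=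
  sSup {r | ∃ (M : Model T) (a : M.Tuple Γ), r = |φ.val M.toMetricStructure a|}

theorem abs_val_le_seminorm (T : Theory L) (φ : BasicFormula L Γ) (M : Model T)
    (a : M.Tuple Γ) : |φ.val M.toMetricStructure a| ≤ seminorm T φ := by
  obtain ⟨B, hB⟩ := PreFormula.exists_bound φ
  exact le_csSup ⟨B, by rintro _ ⟨M, a, rfl⟩; exact hB _ _ _⟩ ⟨M, a, rfl⟩

theorem seminorm_nonneg (T : Theory L) (φ : BasicFormula L Γ) : 0 ≤ seminorm T φ :=
  Real.sSup_nonneg (by rintro _ ⟨M, a, rfl⟩; exact abs_nonneg _)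

theorem seminorm_le (T : Theory L) (φ : BasicFormula L Γ) {C : ℝ} (hC : 0 ≤ C)
    (h : ∀ (M : Model T) (a : M.Tuple Γ), |φ.val M.toMetricStructure a| ≤ C) :
    seminorm T φ ≤ C :=
  Real.sSup_le (by rintro _ ⟨M, a, rfl⟩; exact h M a) hC

/-- Basic formulas in the variables `Γ`, with the pseudometric `‖φ - ψ‖_T`. -/
def BasicFormulaMod (_T : Theory L) {α : Type} (Γ : α → L.Sorts) : Type u := BasicFormula L Γ

theorem seminorm_sub_self (T : Theory L) (φ : BasicFormula L Γ) : seminorm T (φ.sub φ) = 0 :=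
  le_antisymm (seminorm_le T _ le_rfl fun M a => by rw [BasicFormula.val_sub]; simp)
    (seminorm_nonneg T _)

theorem seminorm_sub_comm (T : Theory L) (φ ψ : BasicFormula L Γ) :
    seminorm T (φ.sub ψ) = seminorm T (ψ.sub φ) := by
  unfold seminorm
  simp only [BasicFormula.val_sub, abs_sub_comm]

theorem seminorm_sub_triangle (T : Theory L) (φ ψ χ : BasicFormula L Γ) :
    seminorm T (φ.sub χ) ≤ seminorm T (φ.sub ψ) + seminorm T (ψ.sub χ) := by
  refine seminorm_le T _ (add_nonneg (seminorm_nonneg T _) (seminorm_nonneg T _)) fun M a => ?_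
  have h1 := abs_val_le_seminorm T (φ.sub ψ) M a
  have h2 := abs_val_le_seminorm T (ψ.sub χ) M a
  rw [BasicFormula.val_sub] at h1 h2 ⊢
  exact (abs_sub_le _ (ψ.val M.toMetricStructure a) _).trans (add_le_add h1 h2)

noncomputable instance (T : Theory L) : PseudoMetricSpace (BasicFormulaMod T Γ) where
  dist φ ψ := seminorm T (BasicFormula.sub φ ψ)
  dist_self φ := seminorm_sub_self T φ
  dist_comm φ ψ := seminorm_sub_comm T φ ψ
  dist_triangle φ ψ χ := seminorm_sub_triangle T φ ψ χ

/-- The space of `T`-formulas in the variables listed by `Γ`: the completion of the space of basic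
formulas with respect to `‖·‖_T`. -/
abbrev TFormula (T : Theory L) {α : Type} (Γ : α → L.Sorts) : Type u :=
  UniformSpace.Completion (BasicFormulaMod T Γ)

/-- The value `φ^M(ā)` of a `T`-formula in a model `M` of `T`: the continuous extension of the
evaluation of basic formulas, so that `φ^M(ā) = lim φₙ^M(ā)` when `φ = lim φₙ`. -/
noncomputable def TFormula.val {T : Theory L} (φ : TFormula T Γ) (M : Model T)
    (a : M.Tuple Γ) : ℝ :=
  UniformSpace.Completion.extension
    (fun ψ : BasicFormulaMod T Γ => BasicFormula.val ψ M.toMetricStructure a) φ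

theorem lipschitzWith_val {T : Theory L} (M : Model T) (a : M.Tuple Γ) :
    LipschitzWith 1
      (fun ψ : BasicFormulaMod T Γ => BasicFormula.val ψ M.toMetricStructure a) := by
  refine LipschitzWith.of_dist_le_mul fun φ ψ => ?_
  have h : ∀ φ ψ : BasicFormula L Γ,
      |φ.val M.toMetricStructure a - ψ.val M.toMetricStructure a| ≤ seminorm T (φ.sub ψ) :=
    fun φ ψ => by rw [← BasicFormula.val_sub]; exact abs_val_le_seminorm T _ M a
  rw [NNReal.coe_one, one_mul]
  exact h φ ψ

/-- On basic formulas the value of a `T`-formula is the usual one. -/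
theorem TFormula.val_coe {T : Theory L} (φ : BasicFormulaMod T Γ) (M : Model T)
    (a : M.Tuple Γ) :
    TFormula.val (φ : TFormula T Γ) M a = BasicFormula.val φ M.toMetricStructure a :=
  UniformSpace.Completion.extension_coe (lipschitzWith_val M a).uniformContinuous φ

/-- The value of a `T`-formula depends continuously on the formula. -/
theorem TFormula.continuous_val {T : Theory L} (M : Model T) (a : M.Tuple Γ) :
    Continuous fun φ : TFormula T Γ => φ.val M a :=
  UniformSpace.Completion.continuous_extension

/-- The largest possible value `sup { φ^M(ā) : M ⊨ T, ā ∈ M }` of a `T`-formula. -/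
noncomputable def TFormula.maxValue {T : Theory L} (φ : TFormula T Γ) : ℝ :=
  sSup {r | ∃ (M : Model T) (a : M.Tuple Γ), r = φ.val M a}

/-- The least possible value `inf { φ^M(ā) : M ⊨ T, ā ∈ M }` of a `T`-formula. -/
noncomputable def TFormula.minValue {T : Theory L} (φ : TFormula T Γ) : ℝ :=
  sInf {r | ∃ (M : Model T) (a : M.Tuple Γ), r = φ.val M a}

end Formulas

/-! ### Ultraproducts -/

section Ultraproducts

variable {L : MetricLanguage.{u}} {I : Type u}

/-- The ultralimit of a (bounded) family of real numbers. -/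
noncomputable def ulim (U : Ultrafilter I) (r : I → ℝ) : ℝ := limUnder (U : Filter I) r

theorem tendsto_ulim (U : Ultrafilter I) {r : I → ℝ} {B : ℝ} (h : ∀ i, |r i| ≤ B) :
    Tendsto r U (𝓝 (ulim U r)) := by
  have hc : IsCompact (Set.Icc (-B) B) := isCompact_Icc
  obtain ⟨x, -, hx⟩ := hc.ultrafilter_le_nhds (U.map r)
    (le_principal_iff.2 (Filter.univ_mem' (f := (U : Filter I)) fun i => abs_le.1 (h i)))
  exact tendsto_nhds_limUnder ⟨x, hx⟩

/-- The product `∏ᵢ S^{Mᵢ}`, with the pseudometric `lim_U dᵢ`. -/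
def PreUltraproduct (_U : Ultrafilter I) (M : I → MetricStructure L) (S : L.Sorts) : Type u :=
  ∀ i, (M i).carrier S

theorem tendsto_ulim_dist (U : Ultrafilter I) (M : I → MetricStructure L) {S : L.Sorts}
    (a b : ∀ i, (M i).carrier S) :
    Tendsto (fun i => dist (a i) (b i)) U (𝓝 (ulim U fun i => dist (a i) (b i))) :=
  tendsto_ulim U (B := L.bound S) fun i => by
    rw [abs_of_nonneg dist_nonneg]; exact (M i).dist_le S _ _

noncomputable instance (U : Ultrafilter I) (M : I → MetricStructure L) (S : L.Sorts) :
    PseudoMetricSpace (PreUltraproduct U M S) where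
  dist a b := ulim U fun i => dist (a i) (b i)
  dist_self a := by
    have h := tendsto_ulim_dist U M a a
    simp only [dist_self] at h ⊢
    exact tendsto_nhds_unique h tendsto_const_nhds
  dist_comm a b := by simp only [dist_comm]
  dist_triangle a b c :=
    le_of_tendsto_of_tendsto' (tendsto_ulim_dist U M a c)
      ((tendsto_ulim_dist U M a b).add (tendsto_ulim_dist U M b c))
      fun i => dist_triangle _ _ _

theorem PreUltraproduct.tendsto_dist (U : Ultrafilter I) (M : I → MetricStructure L)
    {S : L.Sorts} (a b : PreUltraproduct U M S) :
    Tendsto (fun i => dist (a i) (b i)) U (𝓝 (dist a b)) :=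
  tendsto_ulim_dist U M a b

/-- The sort `S` of the ultraproduct: the metric space obtained from `∏ᵢ S^{Mᵢ}` by identifying
points at distance `0`. -/
abbrev UltraSort (U : Ultrafilter I) (M : I → MetricStructure L) (S : L.Sorts) : Type u :=
  SeparationQuotient (PreUltraproduct U M S)

/-- The class `[(aᵢ)]_U`. -/
noncomputable def ultraMk (U : Ultrafilter I) (M : I → MetricStructure L) {S : L.Sorts}
    (a : ∀ i, (M i).carrier S) : UltraSort U M S :=
  SeparationQuotient.mk (X := PreUltraproduct U M S) a

theorem ultraMk_surjective (U : Ultrafilter I) (M : I → MetricStructure L) {S : L.Sorts} :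
    Function.Surjective (ultraMk U M (S := S)) :=
  SeparationQuotient.surjective_mk (X := PreUltraproduct U M S)

theorem tendsto_dist_ultraMk (U : Ultrafilter I) (M : I → MetricStructure L) {S : L.Sorts}
    (a b : ∀ i, (M i).carrier S) :
    Tendsto (fun i => dist (a i) (b i)) U (𝓝 (dist (ultraMk U M a) (ultraMk U M b))) :=
  tendsto_ulim_dist U M a b

/-- A representative of an element of the ultraproduct. -/
noncomputable def ultraRep {U : Ultrafilter I} {M : I → MetricStructure L} {S : L.Sorts}
    (x : UltraSort U M S) : ∀ i, (M i).carrier S :=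
  Function.surjInv (ultraMk_surjective U M) x

theorem ultraMk_rep {U : Ultrafilter I} {M : I → MetricStructure L} {S : L.Sorts}
    (x : UltraSort U M S) : ultraMk U M (ultraRep x) = x :=
  Function.surjInv_eq (ultraMk_surjective U M) x

theorem completeSpace_preUltraproduct (U : Ultrafilter I) (M : I → MetricStructure L)
    (S : L.Sorts) : CompleteSpace (PreUltraproduct U M S) := by
  classical
  refine Metric.complete_of_convergent_controlled_sequences (fun n => (1 : ℝ) / 2 / 2 ^ n)
    (fun n => by positivity) fun a ha => ?_
  let good : ℕ → I → Prop := fun k i => ∀ j ≤ k, dist (a j i) (a (j + 1) i) ≤ 1 / 2 / 2 ^ j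
  have hgood : ∀ k, ∀ᶠ i in (U : Filter I), good k i := by
    intro k
    refine (Filter.eventually_all_finite (Set.finite_Iic k)).2 fun j _ => ?_
    have h := (PreUltraproduct.tendsto_dist U M (a j) (a (j + 1))).eventually
      (gt_mem_nhds (ha j j (j + 1) le_rfl (Nat.le_succ j)))
    exact h.mono fun i hi => le_of_lt hi
  let c : ∀ i, ℕ → (M i).carrier S := fun i k =>
    Nat.rec (a 0 i) (fun k x => if good k i then a (k + 1) i else x) k
  have hc1 : ∀ i k, (∀ j < k, good j i) → c i k = a k i := by
    intro i k h
    cases k with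
    | zero => rfl
    | succ k => exact if_pos (h k (Nat.lt_succ_self k))
  have hc2 : ∀ i k, dist (c i k) (c i (k + 1)) ≤ 1 / 2 / 2 ^ k := by
    intro i k
    by_cases h : good k i
    · have h' : ∀ j < k + 1, good j i := fun j hj l hl => h l (by omega)
      rw [hc1 i (k + 1) h', hc1 i k fun j hj => h' j (by omega)]
      exact h k le_rfl
    · have : c i (k + 1) = c i k := if_neg h
      rw [this, dist_self]
      positivity
  have hlim : ∀ i, ∃ b, Tendsto (c i) atTop (𝓝 b) := fun i =>
    cauchySeq_tendsto_of_complete (cauchySeq_of_le_geometric_two (hc2 i))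
  choose b hb using hlim
  have hcb : ∀ i k, dist (c i k) (b i) ≤ 1 / 2 ^ k := fun i k =>
    dist_le_of_le_geometric_two_of_tendsto (hc2 i) (hb i) k
  have hab : ∀ k, dist (a k) (b : PreUltraproduct U M S) ≤ 1 / 2 ^ k := by
    intro k
    refine le_of_tendsto (PreUltraproduct.tendsto_dist U M (a k) b) ?_
    filter_upwards [hgood k] with i hi
    have h : c i k = a k i := hc1 i k fun j hj l hl => hi l (by omega)
    rw [← h]
    exact hcb i k
  refine ⟨b, tendsto_iff_dist_tendsto_zero.2 ?_⟩
  refine squeeze_zero (fun _ => dist_nonneg) hab ?_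
  simpa using tendsto_pow_atTop_nhds_zero_of_lt_one (r := (1 / 2 : ℝ)) (by norm_num) (by norm_num)

/-- Coordinatewise uniform continuity passes to representatives. -/
theorem eventually_dist_lt {U : Ultrafilter I} {M : I → MetricStructure L} {k : ℕ}
    {Δ : Fin k → L.Sorts} (a b : ∀ i, (M i).Tuple Δ) {r : ℝ}
    (h : ∀ j, dist (ultraMk U M fun i => a i j) (ultraMk U M fun i => b i j) < r) :
    ∀ᶠ i in (U : Filter I), ∀ j, dist (a i j) (b i j) < r :=
  Filter.eventually_all.2 fun j =>
    (tendsto_dist_ultraMk U M (fun i => a i j) fun i => b i j).eventually (gt_mem_nhds (h j))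

theorem ultra_func_dist {U : Ultrafilter I} {M : I → MetricStructure L} (f : L.Func)
    {ε : unitInterval} (hε : 0 < ε) (a b : ∀ i, (M i).Tuple (L.funcDom f))
    (h : ∀ j, dist (ultraMk U M fun i => a i j) (ultraMk U M fun i => b i j)
      < ((L.funcModulus f).toFun ε : ℝ)) :
    dist (ultraMk U M fun i => (M i).func f (a i)) (ultraMk U M fun i => (M i).func f (b i))
      ≤ (ε : ℝ) :=
  le_of_tendsto (tendsto_dist_ultraMk U M _ _)
    ((eventually_dist_lt a b h).mono fun i hi => (M i).func_modulus f ε hε _ _ hi)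

theorem ultra_rel_tendsto (U : Ultrafilter I) (M : I → MetricStructure L) (R : L.Rel)
    (a : ∀ i, (M i).Tuple (L.relDom R)) :
    Tendsto (fun i => (M i).rel R (a i)) U (𝓝 (ulim U fun i => (M i).rel R (a i))) :=
  tendsto_ulim U fun i => (M i).rel_le R (a i)

theorem ultra_rel_dist {U : Ultrafilter I} {M : I → MetricStructure L} (R : L.Rel)
    {ε : unitInterval} (hε : 0 < ε) (a b : ∀ i, (M i).Tuple (L.relDom R))
    (h : ∀ j, dist (ultraMk U M fun i => a i j) (ultraMk U M fun i => b i j)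
      < ((L.relModulus R).toFun ε : ℝ)) :
    dist (ulim U fun i => (M i).rel R (a i)) (ulim U fun i => (M i).rel R (b i)) ≤ (ε : ℝ) :=
  le_of_tendsto ((ultra_rel_tendsto U M R a).dist (ultra_rel_tendsto U M R b))
    ((eventually_dist_lt a b h).mono fun i hi => (M i).rel_modulus R ε hε _ _ hi)

/-- The ultraproduct `∏_U Mᵢ`.  Function and relation symbols are computed on representatives;
`ultraproduct_func` and `ultraproduct_rel` say that the choice does not matter. -/
noncomputable def ultraproduct (U : Ultrafilter I) (M : I → MetricStructure L) :
    MetricStructure L where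
  carrier S := UltraSort U M S
  complete S := by
    have := completeSpace_preUltraproduct U M S
    infer_instance
  nonempty S := ⟨ultraMk U M fun i => Classical.choice ((M i).nonempty S)⟩
  dist_le S x y := by
    obtain ⟨a, rfl⟩ := ultraMk_surjective U M x
    obtain ⟨b, rfl⟩ := ultraMk_surjective U M y
    exact le_of_tendsto' (tendsto_dist_ultraMk U M a b) fun i => (M i).dist_le S _ _
  func f x := ultraMk U M fun i => (M i).func f fun j => ultraRep (x j) i
  func_modulus f ε hε x y h :=
    ultra_func_dist f hε _ _ fun j => by simpa only [ultraMk_rep] using h j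
  rel R x := ulim U fun i => (M i).rel R fun j => ultraRep (x j) i
  rel_le R x := le_of_tendsto' (ultra_rel_tendsto U M R _).abs fun i => (M i).rel_le R _
  rel_modulus R ε hε x y h :=
    ultra_rel_dist R hε _ _ fun j => by simpa only [ultraMk_rep] using h j

/-- The tuple of classes `[(āᵢ)]_U`. -/
noncomputable def ultraTuple (U : Ultrafilter I) (M : I → MetricStructure L) {α : Type} {Γ : α → L.Sorts}
    (a : ∀ i, (M i).Tuple Γ) : (ultraproduct U M).Tuple Γ :=
  fun j => ultraMk U M fun i => a i j

theorem unitInterval_le_of_forall {r : ℝ} (h : ∀ ε : unitInterval, 0 < ε → r ≤ (ε : ℝ)) :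
    r ≤ 0 := by
  refine le_of_forall_pos_le_add fun e he => ?_
  have hm : 0 < min e 1 := lt_min he one_pos
  have := h ⟨min e 1, hm.le, min_le_right _ _⟩ (by simpa [← Subtype.coe_lt_coe] using he)
  simpa using this.trans (min_le_left e 1)

theorem ultraproduct_func (U : Ultrafilter I) (M : I → MetricStructure L) (f : L.Func)
    (a : ∀ i, (M i).Tuple (L.funcDom f)) :
    (ultraproduct U M).func f (ultraTuple U M a) = ultraMk U M fun i => (M i).func f (a i) := by
  refine dist_le_zero.1 (unitInterval_le_of_forall fun ε hε => ?_)
  refine ultra_func_dist f hε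
    (fun i j => ultraRep (ultraMk U M fun i => a i j) i) a fun j => ?_
  rw [show ultraMk U M (fun i => ultraRep (ultraMk U M fun i => a i j) i) =
    ultraMk U M fun i => a i j from ultraMk_rep _, dist_self]
  exact_mod_cast (L.funcModulus f).pos' ε hε

theorem ultraproduct_rel (U : Ultrafilter I) (M : I → MetricStructure L) (R : L.Rel)
    (a : ∀ i, (M i).Tuple (L.relDom R)) :
    (ultraproduct U M).rel R (ultraTuple U M a) = ulim U fun i => (M i).rel R (a i) := by
  refine dist_le_zero.1 (unitInterval_le_of_forall fun ε hε => ?_)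
  refine ultra_rel_dist R hε
    (fun i j => ultraRep (ultraMk U M fun i => a i j) i) a fun j => ?_
  rw [show ultraMk U M (fun i => ultraRep (ultraMk U M fun i => a i j) i) =
    ultraMk U M fun i => a i j from ultraMk_rep _, dist_self]
  exact_mod_cast (L.relModulus R).pos' ε hε

theorem ultra_term_eval (U : Ultrafilter I) (M : I → MetricStructure L) {α : Type}
    {Γ : α → L.Sorts} {n : ℕ} {Δ : Fin n → L.Sorts} (v : ∀ i, (M i).Tuple Γ)
    (w : ∀ i, (M i).Tuple Δ) {S : L.Sorts} (t : Term L Γ Δ S) :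
    t.eval (ultraproduct U M) (ultraTuple U M v) (ultraTuple U M w) =
      ultraMk U M fun i => t.eval (M i) (v i) (w i) := by
  induction t with
  | free i => rfl
  | bound j => rfl
  | app f t ih =>
    rw [Term.eval]
    simp only [ih]
    exact ultraproduct_func U M f fun i j => (t j).eval (M i) (v i) (w i)

theorem tendsto_iSup_ultra (U : Ultrafilter I) {A : I → Type u} [∀ i, Nonempty (A i)] {Q : Type u}
    {q : (∀ i, A i) → Q} (hq : Function.Surjective q) {g : ∀ i, A i → ℝ} {G : Q → ℝ} {B : ℝ}
    (hB : ∀ i a, |g i a| ≤ B)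
    (h : ∀ c : ∀ i, A i, Tendsto (fun i => g i (c i)) U (𝓝 (G (q c)))) :
    Tendsto (fun i => ⨆ a, g i a) U (𝓝 (⨆ x, G x)) := by
  have hbdd : ∀ i, BddAbove (Set.range (g i)) := fun i =>
    ⟨B, by rintro _ ⟨a, rfl⟩; exact (abs_le.1 (hB i a)).2⟩
  have hs : ∀ i, |⨆ a, g i a| ≤ B := fun i => abs_le.2
    ⟨(abs_le.1 (hB i (Classical.arbitrary _))).1.trans (le_ciSup (hbdd i) _),
      ciSup_le fun a => (abs_le.1 (hB i a)).2⟩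
  have ht := tendsto_ulim U hs
  have : Nonempty Q := ⟨q fun i => Classical.arbitrary _⟩
  have hle : ∀ x, G x ≤ ulim U fun i => ⨆ a, g i a := by
    intro x
    obtain ⟨c, rfl⟩ := hq x
    exact le_of_tendsto_of_tendsto' (h c) ht fun i => le_ciSup (hbdd i) _
  have heq : (⨆ x, G x) = ulim U fun i => ⨆ a, g i a := by
    refine le_antisymm (ciSup_le hle) (le_of_forall_pos_le_add fun e he => ?_)
    have hex : ∀ i, ∃ a, (⨆ a, g i a) - e < g i a := fun i =>
      exists_lt_of_lt_ciSup (sub_lt_self _ he)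
    choose c hc using hex
    have h1 := le_of_tendsto_of_tendsto' (ht.sub_const e) (h c) fun i => (hc i).le
    have h2 : G (q c) ≤ ⨆ x, G x := le_ciSup ⟨_, by rintro _ ⟨x, rfl⟩; exact hle x⟩ _
    linarith
  rw [heq]
  exact ht

theorem tendsto_iInf_ultra (U : Ultrafilter I) {A : I → Type u} [∀ i, Nonempty (A i)] {Q : Type u}
    {q : (∀ i, A i) → Q} (hq : Function.Surjective q) {g : ∀ i, A i → ℝ} {G : Q → ℝ} {B : ℝ}
    (hB : ∀ i a, |g i a| ≤ B)
    (h : ∀ c : ∀ i, A i, Tendsto (fun i => g i (c i)) U (𝓝 (G (q c)))) :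
    Tendsto (fun i => ⨅ a, g i a) U (𝓝 (⨅ x, G x)) := by
  have key : ∀ {X : Type u} (k : X → ℝ), (⨅ x, k x) = -⨆ x, -k x := by
    intro X k
    rw [iInf, Real.sInf_def, iSup]
    congr 2
    ext r
    simp [neg_eq_iff_eq_neg]
  simp only [key]
  exact (tendsto_iSup_ultra U hq (g := fun i a => -g i a) (G := fun x => -G x) (B := B)
    (fun i a => by simpa using hB i a) fun c => (h c).neg).neg

theorem ultraTuple_consTuple (U : Ultrafilter I) (M : I → MetricStructure L) {n : ℕ}
    {Δ : Fin n → L.Sorts} {S : L.Sorts} (c : ∀ i, (M i).carrier S) (w : ∀ i, (M i).Tuple Δ) :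
    ultraTuple U M (fun i => consTuple (c i) (w i)) =
      consTuple (M := ultraproduct U M) (ultraMk U M c) (ultraTuple U M w) := by
  funext j
  refine Fin.cases ?_ (fun j => ?_) j <;> rfl

/-- Łoś's theorem for basic formulas. -/
theorem ultra_eval (U : Ultrafilter I) (M : I → MetricStructure L) {α : Type}
    {Γ : α → L.Sorts} (v : ∀ i, (M i).Tuple Γ) {n : ℕ} {Δ : Fin n → L.Sorts}
    (φ : PreFormula L Γ n Δ) :
    ∀ w : ∀ i, (M i).Tuple Δ, Tendsto (fun i => φ.eval (M i) (v i) (w i)) U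
      (𝓝 (φ.eval (ultraproduct U M) (ultraTuple U M v) (ultraTuple U M w))) := by
  induction φ with
  | dist t₁ t₂ =>
    intro w
    simp only [PreFormula.eval, ultra_term_eval]
    exact tendsto_dist_ultraMk U M _ _
  | rel R t =>
    intro w
    simp only [PreFormula.eval, ultra_term_eval]
    have h : (ultraproduct U M).rel R
        (fun j => ultraMk U M fun i => (t j).eval (M i) (v i) (w i)) = _ :=
      ultraproduct_rel U M R fun i j => (t j).eval (M i) (v i) (w i)
    rw [h]
    exact ultra_rel_tendsto U M R fun i j => (t j).eval (M i) (v i) (w i)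
  | conn f φ ih =>
    intro w
    simp only [PreFormula.eval]
    exact (f.continuous.tendsto _).comp (tendsto_pi_nhds.2 fun j => ih j w)
  | sup S φ ih =>
    intro w
    obtain ⟨B, hB⟩ := φ.exists_bound
    refine tendsto_iSup_ultra U (ultraMk_surjective U M) (fun i a => hB (M i) (v i) _) fun c => ?_
    have h := ih fun i => consTuple (c i) (w i)
    rw [ultraTuple_consTuple] at h
    exact h
  | inf S φ ih =>
    intro w
    obtain ⟨B, hB⟩ := φ.exists_bound
    refine tendsto_iInf_ultra U (ultraMk_surjective U M) (fun i a => hB (M i) (v i) _) fun c => ?_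
    have h := ih fun i => consTuple (c i) (w i)
    rw [ultraTuple_consTuple] at h
    exact h

/-- The ultraproduct of models of `T` is a model of `T`. -/
noncomputable def Model.ultraproduct {T : Theory L} (U : Ultrafilter I) (M : I → Model T) :
    Model T where
  toMetricStructure := ContinuousLogic.ultraproduct U fun i => (M i).toMetricStructure
  isModel σ hσ := by
    have h := ultra_eval U (fun i => (M i).toMetricStructure) (fun i j => j.elim0) σ
      fun i j => j.elim0
    have h0 : (fun i => PreFormula.eval (M i).toMetricStructure (fun j => j.elim0) σ
        fun j => j.elim0) = fun _ => (0 : ℝ) := funext fun i => (M i).isModel σ hσ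
    rw [h0] at h
    have h1 := tendsto_nhds_unique h tendsto_const_nhds
    unfold BasicFormula.val
    convert h1 using 2

/-- The ultraproduct `∏_U Aᵢ` of subsets `Aᵢ ⊆ S̄(Mᵢ)`, as a subset of `S̄(∏_U Mᵢ)`: the set of all
`[(āᵢ)]_U` with `āᵢ ∈ Aᵢ` for `U`-almost all `i`.  (If all `Aᵢ` are non-empty, one may equivalently
ask that `āᵢ ∈ Aᵢ` for all `i`.) -/
def ultraSet (U : Ultrafilter I) (M : I → MetricStructure L) {n : ℕ} {S : Fin n → L.Sorts}
    (A : ∀ i, Set ((M i).Tuple S)) : Set ((ultraproduct U M).Tuple S) :=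
  {x | ∃ a : ∀ i, (M i).Tuple S, (∀ᶠ i in (U : Filter I), a i ∈ A i) ∧ ultraTuple U M a = x}

end Ultraproducts

/-! ### `T`-functors -/

section Functors

variable {L : MetricLanguage.{u}}

/-- A `T`-functor for `S̄`: a closed subspace `X(M)` of `S̄(M)` for every model `M` of `T`, such that
every elementary embedding `ρ : M → N` restricts to a map `X(M) → X(N)`.  As `X(ρ)` has to be this
restriction, these data determine the functor, and functoriality and isometry are automatic. -/
structure TFunctor (T : Theory L) {n : ℕ} (S : Fin n → L.Sorts) where
  obj : ∀ M : Model T, Set (M.Tuple S)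
  isClosed' : ∀ M, IsClosed (obj M)
  map_mem : ∀ (M N : Model T)
    (ρ : ElementaryEmbedding M.toMetricStructure N.toMetricStructure) (a : M.Tuple S),
    a ∈ obj M → (fun j => ρ.toFun _ (a j)) ∈ obj N

open Classical in
/-- The distance `d(ā, A)` from a tuple to a subset of `S̄(M)`, where `S̄(M)` has the maximum metric.
The distance to the empty set is the upper bound `max B_{Sⱼ}` on that metric. -/
noncomputable def distTo {M : MetricStructure L} {n : ℕ} {S : Fin n → L.Sorts} (a : M.Tuple S)
    (A : Set (M.Tuple S)) : ℝ :=
  if A.Nonempty then Metric.infDist a A else ⨆ j, L.bound (S j)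

open Classical in
/-- `inf { g b : b ∈ A }`, which is `top` if `A` is empty. -/
noncomputable def infOn {β : Type*} (A : Set β) (g : β → ℝ) (top : ℝ) : ℝ :=
  if A.Nonempty then sInf (g '' A) else top

open Classical in
/-- `sup { g b : b ∈ A }`, which is `bot` if `A` is empty. -/
noncomputable def supOn {β : Type*} (A : Set β) (g : β → ℝ) (bot : ℝ) : ℝ :=
  if A.Nonempty then sSup (g '' A) else bot

end Functors

end ContinuousLogic

open ContinuousLogic

/-! The bridge between formulas and ultraproducts is a semantic criterion for definability,
`TFormula.exists_of_ultra`: a real function `F(M, ā)` that commutes with ultralimits and does not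
increase along elementary embeddings is a `T`-formula. Its proof has two parts. If `(M, ā)` and `(N,
b̄)` have the same type, then `N` embeds elementarily into an ultrapower of `M` with `b̄` going to
the diagonal image of `ā` (`exists_embedding_ultrapower`); hence `F(M, ā) ≤ F(N, b̄)`, and by
symmetry `F` depends on the type only. The space of types is compact by Łoś's theorem, `F` is
continuous on it, and by Stone–Weierstrass the basic formulas, which are closed under continuous
connectives and separate types, approximate `F` uniformly.

If `X` commutes with ultraproducts, the criterion applies to the infimum of a `T`-formula over `X`:
near-minimisers in the factors assemble to a near-minimiser in the ultraproduct
(`tendsto_sInf_ultra`), and an embedding can only add points to `X`, so the infimum can only drop.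
Suprema follow by changing signs.

From quantification to the distance, the obstacle is that the two conventions for the empty set
disagree: the infimum of `d` over `∅` is the largest value that `d` attains, whereas `d(ā, ∅)` is
the bound given by the language. So it is first shown that emptiness of `X` is respected by
embeddings and ultraproducts (`TFunctor.nonempty_of_quantification`). For a formula that is not
constant, the infimum over `X` is at most the supremum if `X` is non-empty, and exceeds it by a
fixed gap if `X` is empty; if there is no such formula, every map between models is elementary.

Finally, a distance formula has `X` as its zero set, a slight truncation makes the formula basic,
and Łoś's theorem together with closedness of `X` gives commutation with ultraproducts
(`TFunctor.obj_ultraproduct`). -/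

namespace ContinuousLogic

/-! ### Substitution, connectives and infima over tuples of variables -/

section Substitution

variable {L : MetricLanguage.{u}} {α β : Type} {Γ : α → L.Sorts} {Γ' : β → L.Sorts}

/-- Shift the bound variables of a term to make room for a new variable with index `0`. -/
def Term.lift {n : ℕ} {Δ : Fin n → L.Sorts} (S₀ : L.Sorts) :
    ∀ {S : L.Sorts}, Term L Γ Δ S → Term L Γ (Fin.cons S₀ Δ : Fin (n + 1) → L.Sorts) S
  | _, .free i => .free i
  | _, .bound j => Term.bound (Δ := (Fin.cons S₀ Δ : Fin (n + 1) → L.Sorts)) j.succ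
  | _, .app f t => .app f fun j => (t j).lift S₀

theorem Term.eval_lift (M : MetricStructure L) {n : ℕ} {Δ : Fin n → L.Sorts} {S₀ : L.Sorts}
    (v : M.Tuple Γ) (w : M.Tuple Δ) (b : M.carrier S₀) {S : L.Sorts} (t : Term L Γ Δ S) :
    (t.lift S₀).eval M v (consTuple b w) = t.eval M v w := by
  induction t with
  | free i => rfl
  | bound j => rfl
  | app f t ih => simp only [Term.lift, Term.eval, ih]

/-- Substitute terms for the free and the bound variables of a term. -/
def Term.subst {n m : ℕ} {Δ : Fin n → L.Sorts} {Δ' : Fin m → L.Sorts}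
    (f : ∀ i, Term L Γ Δ (Γ' i)) (g : ∀ j, Term L Γ Δ (Δ' j)) :
    ∀ {S : L.Sorts}, Term L Γ' Δ' S → Term L Γ Δ S
  | _, .free i => f i
  | _, .bound j => g j
  | _, .app h t => .app h fun j => (t j).subst f g

theorem Term.eval_subst (M : MetricStructure L) {n m : ℕ} {Δ : Fin n → L.Sorts}
    {Δ' : Fin m → L.Sorts} (f : ∀ i, Term L Γ Δ (Γ' i)) (g : ∀ j, Term L Γ Δ (Δ' j))
    (v : M.Tuple Γ) (w : M.Tuple Δ) {S : L.Sorts} (t : Term L Γ' Δ' S) :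
    (t.subst f g).eval M v w =
      t.eval M (fun i => (f i).eval M v w) (fun j => (g j).eval M v w) := by
  induction t with
  | free i => rfl
  | bound j => rfl
  | app h t ih => simp only [Term.subst, Term.eval, ih]

/-- Extend a substitution of the bound variables to one more bound variable. -/
def Term.liftSubst {n m : ℕ} {Δ : Fin n → L.Sorts} {Δ' : Fin m → L.Sorts} (S₀ : L.Sorts)
    (g : ∀ j, Term L Γ Δ (Δ' j)) (j : Fin (m + 1)) :
    Term L Γ (Fin.cons S₀ Δ : Fin (n + 1) → L.Sorts)
      ((Fin.cons S₀ Δ' : Fin (m + 1) → L.Sorts) j) :=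
  Fin.cases (motive := fun j => Term L Γ (Fin.cons S₀ Δ : Fin (n + 1) → L.Sorts)
      ((Fin.cons S₀ Δ' : Fin (m + 1) → L.Sorts) j))
    (Term.bound (Δ := (Fin.cons S₀ Δ : Fin (n + 1) → L.Sorts)) 0) (fun j => (g j).lift S₀) j

theorem Term.eval_liftSubst (M : MetricStructure L) {n m : ℕ} {Δ : Fin n → L.Sorts}
    {Δ' : Fin m → L.Sorts} {S₀ : L.Sorts} (g : ∀ j, Term L Γ Δ (Δ' j))
    (v : M.Tuple Γ) (w : M.Tuple Δ) (b : M.carrier S₀) :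
    (fun j => (Term.liftSubst S₀ g j).eval M v (consTuple b w)) =
      consTuple b fun j => (g j).eval M v w := by
  funext j
  refine Fin.cases ?_ (fun j => ?_) j
  · rfl
  · exact Term.eval_lift M v w b (g j)

/-- Substitute terms for the free and the bound variables of a formula. -/
def PreFormula.subst : ∀ {m : ℕ} {Δ' : Fin m → L.Sorts}, PreFormula L Γ' m Δ' →
    ∀ {n : ℕ} {Δ : Fin n → L.Sorts}, (∀ i, Term L Γ Δ (Γ' i)) → (∀ j, Term L Γ Δ (Δ' j)) →
      PreFormula L Γ n Δ
  | _, _, .dist t₁ t₂, _, _, f, g => .dist (t₁.subst f g) (t₂.subst f g)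
  | _, _, .rel R t, _, _, f, g => .rel R fun j => (t j).subst f g
  | _, _, .conn h φ, _, _, f, g => .conn h fun j => (φ j).subst f g
  | _, _, .sup S φ, _, _, f, g => .sup S (φ.subst (fun i => (f i).lift S) (Term.liftSubst S g))
  | _, _, .inf S φ, _, _, f, g => .inf S (φ.subst (fun i => (f i).lift S) (Term.liftSubst S g))

theorem PreFormula.eval_subst (M : MetricStructure L) {m : ℕ} {Δ' : Fin m → L.Sorts}
    (φ : PreFormula L Γ' m Δ') : ∀ {n : ℕ} {Δ : Fin n → L.Sorts}
    (f : ∀ i, Term L Γ Δ (Γ' i)) (g : ∀ j, Term L Γ Δ (Δ' j)) (v : M.Tuple Γ) (w : M.Tuple Δ),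
    (φ.subst f g).eval M v w =
      φ.eval M (fun i => (f i).eval M v w) (fun j => (g j).eval M v w) := by
  induction φ with
  | dist t₁ t₂ => intros; simp only [PreFormula.subst, PreFormula.eval, Term.eval_subst]
  | rel R t => intros; simp only [PreFormula.subst, PreFormula.eval, Term.eval_subst]
  | conn h φ ih => intros; simp only [PreFormula.subst, PreFormula.eval, ih]
  | sup S φ ih =>
    intros
    simp only [PreFormula.subst, PreFormula.eval, ih, Term.eval_lift, Term.eval_liftSubst]
  | inf S φ ih =>
    intros
    simp only [PreFormula.subst, PreFormula.eval, ih, Term.eval_lift, Term.eval_liftSubst]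

/-- Rename the free variables of a basic formula. -/
def BasicFormula.relabel (g : β → α) (φ : BasicFormula L (fun i => Γ (g i))) :
    BasicFormula L Γ :=
  PreFormula.subst φ (fun i => .free (g i)) fun j => j.elim0

theorem BasicFormula.val_relabel (g : β → α) (φ : BasicFormula L (fun i => Γ (g i)))
    (M : MetricStructure L) (v : M.Tuple Γ) :
    (φ.relabel g).val M v = φ.val M fun i => v (g i) := by
  unfold BasicFormula.val BasicFormula.relabel
  rw [PreFormula.eval_subst]
  congr 1
  funext j
  exact j.elim0

theorem BasicFormula.exists_conn (g : ℝ → ℝ → ℝ) (hg : Continuous fun p : ℝ × ℝ => g p.1 p.2)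
    (φ ψ : BasicFormula L Γ) :
    ∃ χ : BasicFormula L Γ, ∀ (M : MetricStructure L) (v : M.Tuple Γ),
      χ.val M v = g (φ.val M v) (ψ.val M v) := by
  have hc : Continuous fun x : Fin 2 → ℝ => g (x 0) (x 1) :=
    hg.comp (f := fun x : Fin 2 → ℝ => (x 0, x 1)) (by fun_prop)
  exact ⟨.conn (k := 2) ⟨_, hc⟩ ![φ, ψ], fun M v => by simp [BasicFormula.val, PreFormula.eval]⟩

/-- The tuple `(w₁, …, wₙ)` obtained by dropping the variable with index `0`. -/
def tailTuple {M : MetricStructure L} {n : ℕ} {Δ : Fin n → L.Sorts} {S : L.Sorts}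
    (w : M.Tuple (Fin.cons S Δ : Fin (n + 1) → L.Sorts)) : M.Tuple Δ :=
  fun j => w j.succ

theorem consTuple_tailTuple {M : MetricStructure L} {n : ℕ} {Δ : Fin n → L.Sorts} {S : L.Sorts}
    (w : M.Tuple (Fin.cons S Δ : Fin (n + 1) → L.Sorts)) :
    consTuple (S := S) (w 0) (tailTuple w) = w := by
  funext j
  refine Fin.cases ?_ (fun j => ?_) j <;> rfl

theorem PreFormula.inf_eval_lt_iff (M : MetricStructure L) (v : M.Tuple Γ) {n : ℕ}
    {Δ : Fin n → L.Sorts} {S : L.Sorts}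
    (φ : PreFormula L Γ (n + 1) (Fin.cons S Δ : Fin (n + 1) → L.Sorts)) (w : M.Tuple Δ) (c : ℝ) :
    (PreFormula.inf S φ).eval M v w < c ↔ ∃ b, φ.eval M v (consTuple b w) < c := by
  obtain ⟨B, hB⟩ := φ.exists_bound
  refine ⟨fun h => exists_lt_of_ciInf_lt h, fun ⟨b, hb⟩ => lt_of_le_of_lt ?_ hb⟩
  exact ciInf_le (f := fun b => φ.eval M v (consTuple b w))
    ⟨-B, by rintro _ ⟨b, rfl⟩; exact (abs_le.1 (hB M v _)).1⟩ b

/-- The strict inequality `< c` turns a bounded infimum into an honest existential statement, so the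
quantifiers can be peeled off one at a time. -/
theorem PreFormula.exists_inf_bound {n : ℕ} {Δ : Fin n → L.Sorts} (φ : PreFormula L Γ n Δ) :
    ∃ χ : BasicFormula L Γ, ∀ (M : MetricStructure L) (v : M.Tuple Γ) (c : ℝ),
      χ.val M v < c ↔ ∃ w : M.Tuple Δ, φ.eval M v w < c := by
  induction n with
  | zero =>
    obtain rfl : Δ = Fin.elim0 := funext fun j => j.elim0
    refine ⟨φ, fun M v c => ⟨fun h => ⟨_, h⟩, fun ⟨w, hw⟩ => ?_⟩⟩
    obtain rfl : w = fun j => j.elim0 := funext fun j => j.elim0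
    exact hw
  | succ n ih =>
    obtain ⟨S, Δ, rfl⟩ : ∃ (S : L.Sorts) (Δ' : Fin n → L.Sorts),
      Δ = (Fin.cons S Δ' : Fin (n + 1) → L.Sorts) := ⟨Δ 0, Fin.tail Δ, (Fin.cons_self_tail Δ).symm⟩
    obtain ⟨χ, hχ⟩ := ih (.inf S φ)
    refine ⟨χ, fun M v c => ?_⟩
    simp only [hχ, PreFormula.inf_eval_lt_iff]
    refine ⟨fun ⟨w, b, h⟩ => ⟨_, h⟩, fun ⟨w, h⟩ => ⟨tailTuple w, w 0, ?_⟩⟩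
    rwa [consTuple_tailTuple]

/-- The infimum over a finite tuple of variables is expressed by a basic formula. -/
theorem BasicFormula.exists_inf {m : ℕ} {Y : Fin m → L.Sorts}
    (φ : BasicFormula L (Sum.elim Γ Y)) :
    ∃ χ : BasicFormula L Γ, ∀ (M : MetricStructure L) (v : M.Tuple Γ) (c : ℝ),
      χ.val M v < c ↔ ∃ w : M.Tuple Y, φ.val M (v.append w) < c := by
  obtain ⟨χ, hχ⟩ := PreFormula.exists_inf_bound (Γ := Γ) (Δ := Y)
    -- The variables to be quantified become bound variables; the others stay free.
    (PreFormula.subst φ (fun k => match k with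
      | .inl i => .free i
      | .inr j => .bound j) fun j => j.elim0)
  refine ⟨χ, fun M v c => ?_⟩
  rw [hχ]
  refine exists_congr fun w => ?_
  rw [PreFormula.eval_subst, BasicFormula.val]
  convert Iff.rfl using 3
  funext k
  cases k <;> rfl

end Substitution

/-! ### Elementary embeddings from preservation of formulas -/

section Embeddings

variable {L : MetricLanguage.{u}}

/-- A map that preserves the values of all formulas is an elementary embedding. -/
def ElementaryEmbedding.ofVal {M N : MetricStructure L} (f : ∀ S, M.carrier S → N.carrier S)
    (hf : ∀ {n : ℕ} (Γ : Fin n → L.Sorts) (φ : BasicFormula L Γ) (a : M.Tuple Γ),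
      φ.val N (fun i => f _ (a i)) = φ.val M a) : ElementaryEmbedding M N where
  toFun := f
  map_dist S a b := by
    simpa [BasicFormula.val, PreFormula.eval, Term.eval] using
      hf (fun _ : Fin 2 => S) (.dist (.free 0) (.free 1)) ![a, b]
  map_func g a := by
    let Γ : Fin (L.funcArity g + 1) → L.Sorts := Fin.cons (L.funcCod g) (L.funcDom g)
    -- The formula `d(x₀, g(x₁, …))` vanishes at `(g(a), a)` in `M`, hence at the image tuple in
    -- `N`.
    have h := hf Γ (.dist (.free (Γ := Γ) 0) (.app g fun j => .free (Γ := Γ) j.succ))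
      (consTuple (M.func g a) a)
    refine dist_le_zero.1 (h.trans ?_).le
    exact dist_self (M.func g a)
  map_rel R a := hf (L.relDom R) (.rel R .free) a
  map_formula := hf

end Embeddings

/-! ### Embedding into an ultrapower a model that realises the same type -/

section UltrapowerEmbedding

variable {L : MetricLanguage.{u}} {α β γ : Type} {Γ : α → L.Sorts}

/-- Rename the last free variables of a basic formula. -/
def BasicFormula.relabelRight {Y : γ → L.Sorts} (g : β → γ)
    (φ : BasicFormula L (Sum.elim Γ fun i => Y (g i))) : BasicFormula L (Sum.elim Γ Y) :=
  PreFormula.subst φ (fun k => match k with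
    | .inl i => Term.free (Γ := Sum.elim Γ Y) (.inl i)
    | .inr j => Term.free (Γ := Sum.elim Γ Y) (.inr (g j))) fun j => j.elim0

theorem BasicFormula.val_relabelRight {Y : γ → L.Sorts} (g : β → γ)
    (φ : BasicFormula L (Sum.elim Γ fun i => Y (g i))) (M : MetricStructure L) (v : M.Tuple Γ)
    (w : M.Tuple Y) :
    (φ.relabelRight g).val M (v.append w) =
      φ.val M (v.append (Δ := fun i => Y (g i)) fun i => w (g i)) := by
  unfold BasicFormula.val BasicFormula.relabelRight
  rw [PreFormula.eval_subst]
  congr 1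
  · funext k
    cases k <;> rfl
  · exact funext fun j => j.elim0

/-- Enumerate the union of the two ranges. Injectivity of the common tuple is what allows values
prescribed along it to be extended to a map on all of `X`. -/
theorem exists_common_injective {X : Type u} {k l : ℕ} (c : Fin k → X) (d : Fin l → X) :
    ∃ (m : ℕ) (e : Fin m → X) (g : Fin k → Fin m) (h : Fin l → Fin m),
      Function.Injective e ∧ c = (fun i => e (g i)) ∧ d = fun i => e (h i) := by
  have e := Finite.equivFin (Set.range (Sum.elim c d))
  let g : Fin k ⊕ Fin l → Set.range (Sum.elim c d) := Set.rangeFactorization _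
  have hg : ∀ i, Sum.elim c d i = (e.symm (e (g i))).1 := fun i => by
    rw [Equiv.symm_apply_apply]
    rfl
  exact ⟨_, fun i => (e.symm i).1, fun i => e (g (.inl i)), fun i => e (g (.inr i)),
    Subtype.val_injective.comp e.symm.injective, funext fun i => hg (.inl i),
    funext fun i => hg (.inr i)⟩

/-- A tuple indexed by an injective family extends to a function on all of the index set. -/
theorem exists_extension {X : Type u} {A : X → Type u} [∀ x, Nonempty (A x)] {k : ℕ}
    {c : Fin k → X} (hc : Function.Injective c) (w : ∀ i, A (c i)) :
    ∃ y : ∀ x, A x, ∀ i, y (c i) = w i := by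
  classical
  refine ⟨fun x => if h : ∃ i, c i = x then h.choose_spec ▸ w h.choose else Classical.arbitrary _,
    fun i => ?_⟩
  have h : ∃ j, c j = c i := ⟨i, rfl⟩
  beta_reduce
  rw [dif_pos h]
  -- The chosen index may differ from `i` syntactically; injectivity identifies the two and makes
  -- the transport trivial.
  have key : ∀ (j : Fin k) (hj : c j = c i), (hj ▸ w j : A (c i)) = w i := by
    intro j hj
    obtain rfl := hc hj
    rfl
  exact key _ h.choose_spec

variable {M N : MetricStructure L}

/-- The maps `y : N → M` for which `θ(ā, y(c̄)) < 0`. -/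
def approxSet (a : M.Tuple Γ) {k : ℕ} (c : Fin k → Σ S, N.carrier S)
    (θ : BasicFormula L (Sum.elim Γ fun i => (c i).1)) : Set (∀ x : Σ S, N.carrier S, M.carrier x.1) :=
  {y | θ.val M (a.append (Δ := fun i => (c i).1) fun i => y (c i)) < 0}

/-- If `(M, ā)` and `(N, b̄)` satisfy the same formulas, there is an ultrafilter on the maps `N → M`
along which all formulas satisfied by `(N, b̄)` are transferred to `(M, ā)`. -/
theorem exists_ultrafilter_approx (a : M.Tuple Γ) (b : N.Tuple Γ)
    (h : ∀ φ : BasicFormula L Γ, φ.val M a = φ.val N b) :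
    ∃ U : Ultrafilter (∀ x : Σ S, N.carrier S, M.carrier x.1),
      ∀ {k : ℕ} (c : Fin k → Σ S, N.carrier S) (θ : BasicFormula L (Sum.elim Γ fun i => (c i).1)),
        θ.val N (b.append (Δ := fun i => (c i).1) fun i => (c i).2) < 0 → approxSet a c θ ∈ U := by
  let P : Type u := {p : Σ k : ℕ, Σ c : Fin k → Σ S, N.carrier S,
      BasicFormula L (Sum.elim Γ fun i => (c i).1) //
    p.2.2.val N (b.append (Δ := fun i => (p.2.1 i).1) fun i => (p.2.1 i).2) < 0}
  let A : P → Set (∀ x : Σ S, N.carrier S, M.carrier x.1) := fun p => approxSet a p.1.2.1 p.1.2.2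
  -- Two conditions `θ < 0` and `η < 0` are jointly the condition `max θ η < 0` on a common
  -- injective tuple.
  have hdir : ∀ p q : P, ∃ r : P, Function.Injective r.1.2.1 ∧ A r ⊆ A p ∩ A q := by
    rintro ⟨⟨k, c, θ⟩, hθ⟩ ⟨⟨l, d, η⟩, hη⟩
    obtain ⟨m, e, g, g', he, rfl, rfl⟩ := exists_common_injective c d
    obtain ⟨χ, hχ⟩ := BasicFormula.exists_conn max continuous_max
      (θ.relabelRight (Y := fun i => (e i).1) g) (η.relabelRight (Y := fun i => (e i).1) g')
    refine ⟨⟨⟨m, e, χ⟩, ?_⟩, he, fun y hy => ?_⟩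
    · dsimp only
      rw [hχ, BasicFormula.val_relabelRight, BasicFormula.val_relabelRight]
      exact max_lt hθ hη
    · simp only [A, approxSet, Set.mem_ofPred_eq] at hy
      rw [hχ, BasicFormula.val_relabelRight, BasicFormula.val_relabelRight] at hy
      exact max_lt_iff.1 hy
  have hne : ∀ p : P, (A p).Nonempty := by
    intro p
    -- Directedness applied to `p` twice replaces its tuple by an injective one.
    obtain ⟨⟨⟨k, c, θ⟩, hθ⟩, hc, hsub⟩ := hdir p p
    refine Set.Nonempty.mono (hsub.trans Set.inter_subset_left) ?_
    obtain ⟨χ, hχ⟩ := BasicFormula.exists_inf θ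
    -- The infimum of `θ` over the tuple is a formula in the variables of `b` alone. It is negative
    -- at `b`, hence at `a`, and so has a witness in `M`.
    have h0 := (hχ N b 0).2 ⟨_, hθ⟩
    rw [← h] at h0
    obtain ⟨w, hw⟩ := (hχ M a 0).1 h0
    obtain ⟨y, hy⟩ := exists_extension (A := fun x : Σ S, N.carrier S => M.carrier x.1) hc w
    refine ⟨y, ?_⟩
    simpa only [A, approxSet, Set.mem_ofPred_eq, hy] using hw
  have hP : Nonempty P := ⟨⟨⟨0, fun i => i.elim0,
    .conn (k := 0) (.const _ (-1)) Fin.elim0⟩, neg_one_lt_zero⟩⟩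
  have hF : (⨅ p, 𝓟 (A p)).NeBot := by
    refine iInf_neBot_of_directed' (fun p q => ?_) fun p => principal_neBot_iff.2 (hne p)
    obtain ⟨r, -, hr⟩ := hdir p q
    exact ⟨r, principal_mono.2 (hr.trans Set.inter_subset_left),
      principal_mono.2 (hr.trans Set.inter_subset_right)⟩
  refine ⟨Ultrafilter.of (⨅ p, 𝓟 (A p)), fun c θ hθ => ?_⟩
  exact Ultrafilter.of_le _ (mem_iInf_of_mem (⟨⟨_, c, θ⟩, hθ⟩ : P) (mem_principal_self _))

/-- Łoś's theorem for the values of basic formulas. -/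
theorem tendsto_val_ultra {I : Type u} (U : Ultrafilter I) (M : I → MetricStructure L)
    (v : ∀ i, (M i).Tuple Γ) (φ : BasicFormula L Γ) :
    Tendsto (fun i => φ.val (M i) (v i)) U (𝓝 (φ.val (ultraproduct U M) (ultraTuple U M v))) := by
  have h := ultra_eval U M v φ fun _ j => j.elim0
  have h0 : ultraTuple U M (fun i j => j.elim0) =
      fun j : Fin 0 => (j.elim0 : (ultraproduct U M).carrier (Fin.elim0 j)) :=
    funext fun j => j.elim0
  rw [h0] at h
  exact h

/-- If `(M, ā)` and `(N, b̄)` satisfy the same formulas, then `N` embeds elementarily into an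
ultrapower of `M`, with `b̄` going to the diagonal image of `ā`. -/
theorem exists_embedding_ultrapower (a : M.Tuple Γ) (b : N.Tuple Γ)
    (h : ∀ φ : BasicFormula L Γ, φ.val M a = φ.val N b) :
    ∃ (I : Type u) (U : Ultrafilter I)
      (ρ : ElementaryEmbedding N (ultraproduct U fun _ : I => M)),
      (fun j => ρ.toFun _ (b j)) = ultraTuple U (fun _ => M) fun _ => a := by
  obtain ⟨U, hU⟩ := exists_ultrafilter_approx a b h
  have key : ∀ {k : ℕ} (c : Fin k → Σ S, N.carrier S)
      (θ : BasicFormula L (Sum.elim Γ fun i => (c i).1)),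
      Tendsto (fun y : ∀ x : Σ S, N.carrier S, M.carrier x.1 =>
        θ.val M (a.append (Δ := fun i => (c i).1) fun i => y (c i))) U
        (𝓝 (θ.val N (b.append (Δ := fun i => (c i).1) fun i => (c i).2))) := by
    intro k c θ
    refine Metric.tendsto_nhds.2 fun ε hε => ?_
    -- The condition that `θ` lies within `ε` of its value in `N` is written as `χ < 0`.
    obtain ⟨χ, hχ⟩ := BasicFormula.exists_conn
      (fun x _ => |x - θ.val N (b.append (Δ := fun i => (c i).1) fun i => (c i).2)| - ε)
      (by fun_prop) θ θ
    filter_upwards [hU c χ (by rw [hχ]; simpa using hε)] with y hy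
    simp only [approxSet, Set.mem_ofPred_eq, hχ] at hy
    rw [Real.dist_eq]
    linarith
  -- The index set consists of the maps `y : N → M`, and `s` goes to the class of the evaluation `y
  -- ↦ y(s)`.
  let ρ : ∀ S, N.carrier S → (ultraproduct U fun _ => M).carrier S :=
    fun S s => ultraMk U (fun _ => M) fun y => y ⟨S, s⟩
  refine ⟨_, U, .ofVal ρ fun {n} Δ φ d => ?_, ?_⟩
  · have h1 := key (fun i => ⟨Δ i, d i⟩) (φ.relabel (Γ := Sum.elim Γ Δ) Sum.inr)
    have h2 := BasicFormula.val_relabel (Γ := Sum.elim Γ Δ) Sum.inr φ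
    refine (tendsto_nhds_unique (tendsto_val_ultra U (fun _ => M) (fun y i => y ⟨Δ i, d i⟩) φ)
      (h1.congr fun y => h2 M _)).trans (h2 N _)
  · funext j
    refine dist_le_zero.1 (le_of_eq ?_)
    -- The formula comparing a new variable, set to `b j`, with the variable at `j` vanishes in `N`,
    -- so the distance from `y(b j)` to `a j` tends to `0`.
    have h1 := key (fun _ : Fin 1 => ⟨Γ j, b j⟩)
      (.dist (.free (Γ := Sum.elim Γ fun _ : Fin 1 => Γ j) (.inr 0))
        (.free (Γ := Sum.elim Γ fun _ : Fin 1 => Γ j) (.inl j)))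
    refine (tendsto_nhds_unique (tendsto_dist_ultraMk U (fun _ => M) _ _) h1).trans ?_
    exact dist_self (b j)

end UltrapowerEmbedding

/-! ### The space of types and the semantic criterion for `T`-formulas -/

section Definability

variable {L : MetricLanguage.{u}} {T : Theory L} {α : Type} {Γ : α → L.Sorts}

theorem TFormula.exists_basic_near (φ : TFormula T Γ) {ε : ℝ} (hε : 0 < ε) :
    ∃ ψ : BasicFormula L Γ, ∀ (M : Model T) (a : M.Tuple Γ),
      |ψ.val M.toMetricStructure a - φ.val M a| ≤ ε := by
  obtain ⟨ψ, hψ⟩ := UniformSpace.Completion.denseRange_coe.exists_dist_lt φ hε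
  refine ⟨ψ, fun M a => ?_⟩
  have h := (UniformSpace.Completion.extension_coe (f := fun ψ : BasicFormulaMod T Γ =>
    BasicFormula.val ψ M.toMetricStructure a) (lipschitzWith_val M a).uniformContinuous ψ)
  have hl := (lipschitzWith_val M a).completion_extension
  have := hl.dist_le_mul (ψ : TFormula T Γ) φ
  rw [h, NNReal.coe_one, one_mul, Real.dist_eq, dist_comm] at this
  exact this.trans hψ.le

/-- A uniform limit of basic formulas is a `T`-formula. -/
theorem TFormula.exists_of_forall_basic_near (F : ∀ M : Model T, M.Tuple Γ → ℝ)
    (h : ∀ ε : ℝ, 0 < ε → ∃ ψ : BasicFormula L Γ, ∀ (M : Model T) (a : M.Tuple Γ),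
      |ψ.val M.toMetricStructure a - F M a| ≤ ε) :
    ∃ φ : TFormula T Γ, ∀ (M : Model T) (a : M.Tuple Γ), φ.val M a = F M a := by
  have hpos : ∀ n : ℕ, (0 : ℝ) < 1 / (n + 1) := fun n => Nat.one_div_pos_of_nat
  choose ψ hψ using fun n : ℕ => h (1 / (n + 1)) (hpos n)
  let Ψ : ℕ → BasicFormulaMod T Γ := ψ
  have hdist : ∀ m n : ℕ, dist (Ψ m) (Ψ n) ≤ 1 / ((m : ℝ) + 1) + 1 / ((n : ℝ) + 1) := by
    intro m n
    refine seminorm_le T _ (add_pos (hpos m) (hpos n)).le fun M a => ?_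
    rw [BasicFormula.val_sub]
    have h1 := hψ m M a
    have h2 := hψ n M a
    rw [abs_sub_comm] at h2
    exact (abs_sub_le _ (F M a) _).trans (add_le_add h1 h2)
  have hc : CauchySeq fun n => (Ψ n : TFormula T Γ) := by
    refine cauchySeq_of_le_tendsto_0 (fun n : ℕ => 2 * (1 / ((n : ℝ) + 1))) (fun m n N hm hn => ?_) ?_
    · rw [UniformSpace.Completion.dist_eq, two_mul]
      exact (hdist m n).trans (add_le_add (Nat.one_div_le_one_div hm) (Nat.one_div_le_one_div hn))
    · simpa using tendsto_one_div_add_atTop_nhds_zero_nat.const_mul (2 : ℝ)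
  obtain ⟨φ, hφ⟩ := cauchySeq_tendsto_of_complete hc
  refine ⟨φ, fun M a => ?_⟩
  refine tendsto_nhds_unique (((TFormula.continuous_val M a).tendsto φ).comp hφ) ?_
  refine tendsto_iff_dist_tendsto_zero.2 (squeeze_zero (fun _ => dist_nonneg) (fun n => ?_)
    tendsto_one_div_add_atTop_nhds_zero_nat)
  rw [Function.comp_apply, TFormula.val_coe, Real.dist_eq]
  exact hψ n M a

theorem TFormula.exists_bound (φ : TFormula T Γ) :
    ∃ B : ℝ, ∀ (M : Model T) (a : M.Tuple Γ), |φ.val M a| ≤ B := by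
  obtain ⟨ψ, hψ⟩ := φ.exists_basic_near one_pos
  obtain ⟨B, hB⟩ := PreFormula.exists_bound ψ
  refine ⟨B + 1, fun M a => ?_⟩
  have h1 : |ψ.val M.toMetricStructure a| ≤ B := hB _ _ _
  have h2 := hψ M a
  rw [abs_le] at *
  constructor <;> linarith

theorem TFormula.val_le_maxValue (φ : TFormula T Γ) (M : Model T) (a : M.Tuple Γ) :
    φ.val M a ≤ φ.maxValue := by
  obtain ⟨B, hB⟩ := φ.exists_bound
  exact le_csSup ⟨B, by rintro _ ⟨M, a, rfl⟩; exact (abs_le.1 (hB M a)).2⟩ ⟨M, a, rfl⟩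

theorem TFormula.minValue_le_val (φ : TFormula T Γ) (M : Model T) (a : M.Tuple Γ) :
    φ.minValue ≤ φ.val M a := by
  obtain ⟨B, hB⟩ := φ.exists_bound
  exact csInf_le ⟨-B, by rintro _ ⟨M, a, rfl⟩; exact (abs_le.1 (hB M a)).1⟩ ⟨M, a, rfl⟩

/-- Łoś's theorem for `T`-formulas. -/
theorem TFormula.tendsto_val_ultra {I : Type u} (U : Ultrafilter I) (M : I → Model T)
    (a : ∀ i, (M i).Tuple Γ) (φ : TFormula T Γ) :
    Tendsto (fun i => φ.val (M i) (a i)) U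
      (𝓝 (φ.val (Model.ultraproduct U M) (ultraTuple U (fun i => (M i).toMetricStructure) a))) := by
  refine Metric.tendsto_nhds.2 fun ε hε => ?_
  obtain ⟨ψ, hψ⟩ := φ.exists_basic_near (ε := ε / 4) (by positivity)
  have h := ContinuousLogic.tendsto_val_ultra U (fun i => (M i).toMetricStructure) a ψ
  filter_upwards [Metric.tendsto_nhds.1 h (ε / 4) (by positivity)] with i hi
  have h1 := hψ (M i) (a i)
  have h2 := hψ (Model.ultraproduct U M) (ultraTuple U (fun i => (M i).toMetricStructure) a)
  have h3 : |ψ.val (M i).toMetricStructure (a i) - ψ.val (Model.ultraproduct U M).toMetricStructure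
    (ultraTuple U (fun i => (M i).toMetricStructure) a)| < ε / 4 := hi
  rw [Real.dist_eq]
  rw [abs_le] at h1 h2
  rw [abs_lt] at h3 ⊢
  constructor <;> linarith

/-- Elementary embeddings preserve the values of basic formulas in any finite set of variables. -/
theorem ElementaryEmbedding.val_map [Finite α] {M N : MetricStructure L}
    (ρ : ElementaryEmbedding M N) (φ : BasicFormula L Γ) (a : M.Tuple Γ) :
    φ.val N (fun i => ρ.toFun _ (a i)) = φ.val M a := by
  obtain ⟨k, ⟨e⟩⟩ := Finite.exists_equiv_fin α
  -- Choosing terms, rather than re-indexing variables, avoids a transport along `e.symm (e i) = i`.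
  have hex : ∀ i, ∃ t : Term L (fun j => Γ (e.symm j)) Fin.elim0 (Γ i),
      ∀ (M : MetricStructure L) (v : M.Tuple Γ),
        t.eval M (fun j => v (e.symm j)) (fun j => j.elim0) = v i := by
    intro i
    obtain ⟨j, rfl⟩ := e.symm.surjective i
    exact ⟨.free j, fun M v => rfl⟩
  choose t ht using hex
  have key : ∀ (M : MetricStructure L) (v : M.Tuple Γ),
      BasicFormula.val (PreFormula.subst φ t fun j => j.elim0) M (fun j => v (e.symm j)) =
        φ.val M v := by
    intro M v
    unfold BasicFormula.val
    rw [PreFormula.eval_subst]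
    simp only [ht]
    congr 1
    exact funext fun j => j.elim0
  rw [← key, ← key]
  exact ρ.map_formula _ _ _

/-- Elementary embeddings preserve the values of `T`-formulas. -/
theorem TFormula.val_map [Finite α] (φ : TFormula T Γ) {M N : Model T}
    (ρ : ElementaryEmbedding M.toMetricStructure N.toMetricStructure) (a : M.Tuple Γ) :
    φ.val N (fun j => ρ.toFun _ (a j)) = φ.val M a := by
  induction φ using UniformSpace.Completion.induction_on with
  | hp => exact isClosed_eq (TFormula.continuous_val _ _) (TFormula.continuous_val _ _)
  | ih ψ =>
    rw [TFormula.val_coe, TFormula.val_coe]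
    exact ρ.val_map ψ a

/-- The type of a tuple in a model. -/
noncomputable def typeOf (M : MetricStructure L) (a : M.Tuple Γ) : BasicFormula L Γ → ℝ :=
  fun φ => φ.val M a

/-- The space of types realised in models of `T`. -/
def typeSpace (T : Theory L) {α : Type} (Γ : α → L.Sorts) : Set (BasicFormula L Γ → ℝ) :=
  {p | ∃ (M : Model T) (a : M.Tuple Γ), typeOf M.toMetricStructure a = p}

/-- By Łoś's theorem, an ultrafilter of types converges to the type realised in the ultraproduct of
realisations, indexed by the types themselves. -/
theorem isCompact_typeSpace : IsCompact (typeSpace T Γ) := by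
  classical
  refine isCompact_iff_ultrafilter_le_nhds.2 fun U hU => ?_
  have hU' : typeSpace T Γ ∈ U := le_principal_iff.1 hU
  obtain ⟨p₀, hp₀⟩ := U.nonempty_of_mem hU'
  -- The index set also contains functions that are not types. They get an arbitrary realisation,
  -- which does not matter because `U` contains the type space.
  have hex : ∀ p : BasicFormula L Γ → ℝ, ∃ (M : Model T) (a : M.Tuple Γ),
      p ∈ typeSpace T Γ → typeOf M.toMetricStructure a = p := by
    intro p
    by_cases hp : p ∈ typeSpace T Γ
    · obtain ⟨M, a, h⟩ := hp
      exact ⟨M, a, fun _ => h⟩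
    · obtain ⟨M, a, h⟩ := hp₀
      exact ⟨M, a, fun h => absurd h hp⟩
  choose M a hMa using hex
  refine ⟨_, ⟨Model.ultraproduct U M, ultraTuple U _ a, rfl⟩, tendsto_pi_nhds.2 fun φ => ?_⟩
  refine (tendsto_val_ultra U (fun i => (M i).toMetricStructure) a φ).congr' ?_
  filter_upwards [hU'] with p hp
  exact congrFun (hMa p hp) φ

/-- The algebra of functions on the type space given by basic formulas. -/
def formulaSubalgebra (T : Theory L) {α : Type} (Γ : α → L.Sorts) :
    Subalgebra ℝ C(typeSpace T Γ, ℝ) where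
  carrier := {f | ∃ φ : BasicFormula L Γ, ∀ p, f p = p.1 φ}
  mul_mem' := by
    rintro f g ⟨φ, hφ⟩ ⟨ψ, hψ⟩
    obtain ⟨χ, hχ⟩ := BasicFormula.exists_conn (· * ·) (by fun_prop) φ ψ
    refine ⟨χ, fun p => ?_⟩
    obtain ⟨M, a, hp⟩ := p.2
    rw [ContinuousMap.mul_apply, hφ, hψ, ← hp]
    exact (hχ _ _).symm
  add_mem' := by
    rintro f g ⟨φ, hφ⟩ ⟨ψ, hψ⟩
    obtain ⟨χ, hχ⟩ := BasicFormula.exists_conn (· + ·) (by fun_prop) φ ψ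
    refine ⟨χ, fun p => ?_⟩
    obtain ⟨M, a, hp⟩ := p.2
    rw [ContinuousMap.add_apply, hφ, hψ, ← hp]
    exact (hχ _ _).symm
  algebraMap_mem' := fun r => ⟨.conn (k := 0) (.const _ r) Fin.elim0, fun p => by
    obtain ⟨M, a, hp⟩ := p.2
    rw [← hp]
    rfl⟩

theorem separatesPoints_formulaSubalgebra : (formulaSubalgebra T Γ).SeparatesPoints := by
  intro p q hpq
  obtain ⟨φ, hφ⟩ := Function.ne_iff.1 fun h => hpq (Subtype.ext h)
  exact ⟨_, ⟨⟨fun p => p.1 φ, (continuous_apply φ).comp continuous_subtype_val⟩,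
    ⟨φ, fun _ => rfl⟩, rfl⟩, hφ⟩

/-- A real-valued function on the realisations of types that is continuous with respect to
ultraproducts and depends only on the type is a uniform limit of basic formulas. -/
theorem exists_basic_near_of_type_invariant (F : ∀ M : Model T, M.Tuple Γ → ℝ)
    (hultra : ∀ (I : Type u) (U : Ultrafilter I) (M : I → Model T) (a : ∀ i, (M i).Tuple Γ),
      Tendsto (fun i => F (M i) (a i)) U
        (𝓝 (F (Model.ultraproduct U M) (ultraTuple U (fun i => (M i).toMetricStructure) a))))
    (htype : ∀ (M N : Model T) (a : M.Tuple Γ) (b : N.Tuple Γ),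
      typeOf M.toMetricStructure a = typeOf N.toMetricStructure b → F M a = F N b)
    {ε : ℝ} (hε : 0 < ε) :
    ∃ ψ : BasicFormula L Γ, ∀ (M : Model T) (a : M.Tuple Γ),
      |ψ.val M.toMetricStructure a - F M a| ≤ ε := by
  have : CompactSpace (typeSpace T Γ) := isCompact_iff_compactSpace.1 isCompact_typeSpace
  choose M a hMa using fun p : typeSpace T Γ => p.2
  have hcont : Continuous fun p : typeSpace T Γ => F (M p) (a p) := by
    refine continuous_iff_ultrafilter.2 fun p U hU => ?_
    have h := hultra _ U M a
    -- Along `U`, `F` tends to its value at the ultraproduct of the chosen realisations, and the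
    -- type there is the limit `p`.
    suffices htp : typeOf (Model.ultraproduct U M).toMetricStructure
        (ultraTuple U (fun i => (M i).toMetricStructure) a) = typeOf (M p).toMetricStructure (a p) by
      rwa [htype _ _ _ _ htp] at h
    rw [hMa p]
    funext φ
    refine tendsto_nhds_unique (tendsto_val_ultra U (fun i => (M i).toMetricStructure) a φ) ?_
    have hp : Tendsto (fun q : typeSpace T Γ => q.1 φ) U (𝓝 (p.1 φ)) :=
      (((continuous_apply φ).comp continuous_subtype_val).tendsto p).mono_left hU
    exact hp.congr fun q => (congrFun (hMa q) φ).symm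
  obtain ⟨⟨g, hg⟩, hgF⟩ :=
    ContinuousMap.exists_mem_subalgebra_near_continuousMap_of_separatesPoints _
      separatesPoints_formulaSubalgebra ⟨_, hcont⟩ ε hε
  obtain ⟨φ, hφ⟩ := hg
  refine ⟨φ, fun N b => ?_⟩
  obtain ⟨p, hp⟩ : ∃ p : typeSpace T Γ, p.1 = typeOf N.toMetricStructure b := ⟨⟨_, N, b, rfl⟩, rfl⟩
  have h := (ContinuousMap.norm_coe_le_norm _ p).trans hgF.le
  have h1 : F (M p) (a p) = F N b := htype _ _ _ _ ((hMa p).trans hp)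
  have h2 : g p = φ.val N.toMetricStructure b := (hφ p).trans (congrFun hp φ)
  rw [ContinuousMap.sub_apply, h2, ContinuousMap.coe_mk, h1] at h
  exact h

/-- A real-valued function of tuples in models of `T` that is continuous with respect to
ultraproducts and does not increase along elementary embeddings is a `T`-formula. -/
theorem TFormula.exists_of_ultra {m : ℕ} {Y : Fin m → L.Sorts}
    (F : ∀ M : Model T, M.Tuple Y → ℝ)
    (hultra : ∀ (I : Type u) (U : Ultrafilter I) (M : I → Model T) (a : ∀ i, (M i).Tuple Y),
      Tendsto (fun i => F (M i) (a i)) U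
        (𝓝 (F (Model.ultraproduct U M) (ultraTuple U (fun i => (M i).toMetricStructure) a))))
    (hle : ∀ (M N : Model T) (ρ : ElementaryEmbedding M.toMetricStructure N.toMetricStructure)
      (a : M.Tuple Y), F N (fun j => ρ.toFun _ (a j)) ≤ F M a) :
    ∃ φ : TFormula T Y, ∀ (M : Model T) (a : M.Tuple Y), φ.val M a = F M a := by
  have key : ∀ (M N : Model T) (a : M.Tuple Y) (b : N.Tuple Y),
      typeOf M.toMetricStructure a = typeOf N.toMetricStructure b → F M a ≤ F N b := by
    intro M N a b h
    -- On a constant family the ultralimit is `F M a`, so this is also the value of `F` at the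
    -- diagonal image of `a`, which is `ρ(b)`.
    obtain ⟨I, U, ρ, hρ⟩ := exists_embedding_ultrapower a b (congrFun h)
    have h1 := hle N (Model.ultraproduct U fun _ => M) ρ b
    rw [hρ] at h1
    rwa [← tendsto_nhds_unique (hultra I U (fun _ => M) fun _ => a) tendsto_const_nhds]
  exact exists_of_forall_basic_near F fun ε hε => exists_basic_near_of_type_invariant F hultra
    (fun M N a b h => le_antisymm (key M N a b h) (key N M b a h.symm)) hε

end Definability

/-! ### Distance to a set and the maximum metric -/

section Distance

variable {L : MetricLanguage.{u}} {n : ℕ} {S : Fin n → L.Sorts}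

theorem distTo_of_nonempty {M : MetricStructure L} (a : M.Tuple S) {A : Set (M.Tuple S)}
    (hA : A.Nonempty) : distTo a A = Metric.infDist a A := if_pos hA

theorem distTo_of_not_nonempty {M : MetricStructure L} (a : M.Tuple S) {A : Set (M.Tuple S)}
    (hA : ¬A.Nonempty) : distTo a A = ⨆ j, L.bound (S j) := if_neg hA

theorem iSup_bound_pos (hn : 0 < n) (S : Fin n → L.Sorts) : 0 < ⨆ j, L.bound (S j) :=
  (L.bound_pos (S ⟨0, hn⟩)).trans_le
    (le_ciSup (f := fun j => L.bound (S j)) (Set.finite_range _).bddAbove _)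

theorem nonempty_of_distTo_lt {M : MetricStructure L} {a : M.Tuple S} {A : Set (M.Tuple S)}
    (h : distTo a A < ⨆ j, L.bound (S j)) : A.Nonempty := by
  by_contra hA
  exact h.ne (distTo_of_not_nonempty a hA)

/-- The maximum metric on tuples is given by a basic formula. -/
theorem BasicFormula.exists_dist (S : Fin n → L.Sorts) :
    ∃ δ : BasicFormula L (Sum.elim S S), ∀ (M : MetricStructure L) (x y : M.Tuple S),
      δ.val M (x.append y) = dist x y := by
  refine ⟨.conn (k := n) ⟨fun v => ‖v‖, continuous_norm⟩ fun j =>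
    .dist (.free (Γ := Sum.elim S S) (.inl j)) (.free (Γ := Sum.elim S S) (.inr j)),
    fun M x y => ?_⟩
  change ‖fun j => dist (x j) (y j)‖ = dist x y
  refine le_antisymm ((pi_norm_le_iff_of_nonneg dist_nonneg).2 fun j => ?_)
    ((dist_pi_le_iff (norm_nonneg _)).2 fun j => ?_)
  · rw [Real.norm_of_nonneg dist_nonneg]
    exact dist_le_pi_dist x y j
  · exact (Real.le_norm_self _).trans (norm_le_pi_norm (fun j => dist (x j) (y j)) j)

end Distance

/-! ### Infima and suprema over a functor commuting with ultraproducts -/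

section Quantification

variable {L : MetricLanguage.{u}} {T : Theory L}

theorem infOn_of_nonempty {β : Type*} {A : Set β} (hA : A.Nonempty) (g : β → ℝ) (top : ℝ) :
    infOn A g top = sInf (g '' A) := if_pos hA

theorem infOn_of_not_nonempty {β : Type*} {A : Set β} (hA : ¬A.Nonempty) (g : β → ℝ) (top : ℝ) :
    infOn A g top = top := if_neg hA

theorem supOn_of_nonempty {β : Type*} {A : Set β} (hA : A.Nonempty) (g : β → ℝ) (bot : ℝ) :
    supOn A g bot = sSup (g '' A) := if_pos hA

theorem supOn_of_not_nonempty {β : Type*} {A : Set β} (hA : ¬A.Nonempty) (g : β → ℝ) (bot : ℝ) :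
    supOn A g bot = bot := if_neg hA

theorem infOn_neg {β : Type*} (A : Set β) (g : β → ℝ) (bot : ℝ) :
    infOn A (fun b => -g b) (-bot) = -supOn A g bot := by
  unfold infOn supOn
  split_ifs
  · rw [Real.sInf_def, ← Set.image_neg_eq_neg, Set.image_image]
    simp
  · rfl

theorem supOn_neg {β : Type*} (A : Set β) (g : β → ℝ) (top : ℝ) :
    supOn A (fun b => -g b) (-top) = -infOn A g top := by
  have h := infOn_neg A (fun b => -g b) (-top)
  simp only [neg_neg] at h
  rw [h, neg_neg]

theorem TFormula.exists_neg {α : Type} {Γ : α → L.Sorts} (φ : TFormula T Γ) :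
    ∃ φ' : TFormula T Γ, ∀ (M : Model T) (a : M.Tuple Γ), φ'.val M a = -φ.val M a := by
  refine exists_of_forall_basic_near _ fun ε hε => ?_
  obtain ⟨ψ, hψ⟩ := φ.exists_basic_near hε
  obtain ⟨χ, hχ⟩ := BasicFormula.exists_conn (fun x _ => -x) (by fun_prop) ψ ψ
  refine ⟨χ, fun M a => ?_⟩
  rw [hχ, ← neg_sub', abs_neg]
  exact hψ M a

theorem TFormula.minValue_of_neg {α : Type} {Γ : α → L.Sorts} {φ φ' : TFormula T Γ}
    (h : ∀ (M : Model T) (a : M.Tuple Γ), φ'.val M a = -φ.val M a) :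
    φ'.minValue = -φ.maxValue := by
  unfold minValue maxValue
  rw [Real.sInf_def]
  congr 2
  ext r
  simp [h]

theorem TFormula.maxValue_of_neg {α : Type} {Γ : α → L.Sorts} {φ φ' : TFormula T Γ}
    (h : ∀ (M : Model T) (a : M.Tuple Γ), φ'.val M a = -φ.val M a) :
    φ'.maxValue = -φ.minValue := by
  rw [minValue_of_neg (φ := φ') (φ' := φ) fun M a => by rw [h, neg_neg], neg_neg]

/-- The ultralimit of the infima is a lower bound for `G` on `C`, and a family of near-minimisers
defines a point of `C` where `G` almost attains it. Non-emptiness almost everywhere is needed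
because `sInf ∅ = 0`. -/
theorem tendsto_sInf_ultra {I : Type u} (U : Ultrafilter I) {β : I → Type u}
    [∀ i, Nonempty (β i)] {Q : Type u} {A : ∀ i, Set (β i)} {C : Set Q} {q : (∀ i, β i) → Q}
    (hne : ∀ᶠ i in (U : Filter I), (A i).Nonempty)
    (hC : C = {x | ∃ a, (∀ᶠ i in (U : Filter I), a i ∈ A i) ∧ q a = x})
    {g : ∀ i, β i → ℝ} {G : Q → ℝ} {B : ℝ} (hB : ∀ i a, |g i a| ≤ B)
    (h : ∀ c : ∀ i, β i, Tendsto (fun i => g i (c i)) U (𝓝 (G (q c)))) :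
    Tendsto (fun i => sInf (g i '' A i)) U (𝓝 (sInf (G '' C))) := by
  have hbdd : ∀ i, BddBelow (g i '' A i) := fun i =>
    ⟨-B, by rintro _ ⟨a, -, rfl⟩; exact (abs_le.1 (hB i a)).1⟩
  have hB0 : 0 ≤ B := by
    obtain ⟨i, a, -⟩ := hne.exists
    exact (abs_nonneg _).trans (hB i a)
  have hs : ∀ i, |sInf (g i '' A i)| ≤ B := by
    intro i
    rcases (A i).eq_empty_or_nonempty with h0 | ⟨a, ha⟩
    · simpa [h0] using hB0
    · refine abs_le.2 ⟨le_csInf ⟨_, a, ha, rfl⟩ ?_,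
        (csInf_le (hbdd i) ⟨a, ha, rfl⟩).trans (abs_le.1 (hB i a)).2⟩
      rintro _ ⟨a, -, rfl⟩
      exact (abs_le.1 (hB i a)).1
  have ht := tendsto_ulim U hs
  have hlb : ∀ x ∈ C, (ulim U fun i => sInf (g i '' A i)) ≤ G x := by
    rw [hC]
    rintro _ ⟨a, ha, rfl⟩
    exact le_of_tendsto_of_tendsto ht (h a)
      (ha.mono fun i hi => csInf_le (hbdd i) ⟨_, hi, rfl⟩)
  have hex : ∀ e : ℝ, 0 < e → ∃ x ∈ C, G x ≤ (ulim U fun i => sInf (g i '' A i)) + e := by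
    intro e he
    have h1 : ∀ i, ∃ a, (A i).Nonempty → a ∈ A i ∧ g i a ≤ sInf (g i '' A i) + e := by
      intro i
      by_cases hA : (A i).Nonempty
      · obtain ⟨_, ⟨a, ha, rfl⟩, hlt⟩ :=
          exists_lt_of_csInf_lt (hA.image (g i)) (lt_add_of_pos_right (sInf (g i '' A i)) he)
        exact ⟨a, fun _ => ⟨ha, hlt.le⟩⟩
      · exact ⟨Classical.arbitrary _, fun h => absurd h hA⟩
    choose c hc using h1
    refine ⟨q c, ?_, le_of_tendsto_of_tendsto (h c) (ht.add_const e)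
      (hne.mono fun i hi => (hc i hi).2)⟩
    rw [hC]
    exact ⟨c, hne.mono fun i hi => (hc i hi).1, rfl⟩
  have heq : sInf (G '' C) = ulim U fun i => sInf (g i '' A i) := by
    refine le_antisymm (le_of_forall_pos_le_add fun e he => ?_) ?_
    · obtain ⟨x, hx, hle⟩ := hex e he
      refine (csInf_le ⟨ulim U fun i => sInf (g i '' A i), ?_⟩ (Set.mem_image_of_mem G hx)).trans hle
      rintro _ ⟨y, hy, rfl⟩
      exact hlb y hy
    · obtain ⟨x, hx, -⟩ := hex 1 one_pos
      refine le_csInf ⟨_, x, hx, rfl⟩ ?_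
      rintro _ ⟨y, hy, rfl⟩
      exact hlb y hy
  rw [heq]
  exact ht

theorem ultraTuple_append {I : Type u} (U : Ultrafilter I) (M : I → MetricStructure L)
    {α β : Type} {Γ : α → L.Sorts} {Δ : β → L.Sorts} (b : ∀ i, (M i).Tuple Γ)
    (a : ∀ i, (M i).Tuple Δ) :
    ultraTuple U M (fun i => (b i).append (a i)) =
      MetricStructure.Tuple.append (M := ultraproduct U M) (ultraTuple U M b) (ultraTuple U M a) := by
  funext k
  cases k <;> rfl

variable {n m : ℕ} {S : Fin n → L.Sorts} {Y : Fin m → L.Sorts}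

theorem ElementaryEmbedding.map_append {M N : MetricStructure L} (ρ : ElementaryEmbedding M N)
    (b : M.Tuple S) (a : M.Tuple Y) :
    (fun k => ρ.toFun _ (b.append a k)) =
      MetricStructure.Tuple.append (Γ := S) (Δ := Y) (fun j => ρ.toFun _ (b j))
        fun j => ρ.toFun _ (a j) := by
  funext k
  cases k <;> rfl

/-- Elementary embeddings preserve the values of `T`-formulas in any finite set of variables. -/
theorem TFormula.val_map_append (ψ : TFormula T (Sum.elim S Y)) {M N : Model T}
    (ρ : ElementaryEmbedding M.toMetricStructure N.toMetricStructure) (b : M.Tuple S)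
    (a : M.Tuple Y) :
    ψ.val N (MetricStructure.Tuple.append (Γ := S) (Δ := Y) (fun j => ρ.toFun _ (b j))
      fun j => ρ.toFun _ (a j)) = ψ.val M (b.append a) := by
  rw [← ψ.val_map ρ, ElementaryEmbedding.map_append]

/-- If `X` commutes with ultraproducts, one can take the infimum over `X`. -/
theorem TFunctor.exists_infOn (X : TFunctor T S)
    (hX : ∀ (I : Type u) (U : Ultrafilter I) (M : I → Model T),
      X.obj (Model.ultraproduct U M) =
        ultraSet U (fun i => (M i).toMetricStructure) fun i => X.obj (M i))
    (ψ : TFormula T (Sum.elim S Y)) :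
    ∃ χ : TFormula T Y, ∀ (M : Model T) (a : M.Tuple Y),
      χ.val M a = infOn (X.obj M) (fun b => ψ.val M (b.append a)) ψ.maxValue := by
  obtain ⟨B, hB⟩ := ψ.exists_bound
  refine TFormula.exists_of_ultra _ (fun I U M a => ?_) fun M N ρ a => ?_
  · by_cases hne : ∀ᶠ i in (U : Filter I), (X.obj (M i)).Nonempty
    · have h := tendsto_sInf_ultra U (β := fun i => (M i).Tuple S)
        (Q := (Model.ultraproduct U M).Tuple S) (A := fun i => X.obj (M i))
        (q := ultraTuple U fun i => (M i).toMetricStructure) hne (hX I U M)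
        (g := fun i b => ψ.val (M i) (b.append (a i)))
        (G := fun b => ψ.val (Model.ultraproduct U M)
          (b.append (ultraTuple U (fun i => (M i).toMetricStructure) a)))
        (fun i b => hB (M i) _) fun c => by
          have h := ψ.tendsto_val_ultra U M fun i => (c i).append (a i)
          rwa [ultraTuple_append] at h
      rw [infOn_of_nonempty]
      · exact h.congr' (hne.mono fun i hi => (infOn_of_nonempty hi _ _).symm)
      · rw [hX]
        have hex : ∀ i, ∃ b : (M i).Tuple S, (X.obj (M i)).Nonempty → b ∈ X.obj (M i) := by
          intro i
          by_cases h : (X.obj (M i)).Nonempty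
          · exact ⟨_, fun _ => h.some_mem⟩
          · exact ⟨Classical.arbitrary _, fun h' => absurd h' h⟩
        choose b hb using hex
        exact ⟨_, b, hne.mono hb, rfl⟩
    -- For an ultrafilter, failing to be non-empty almost everywhere means being empty almost
    -- everywhere, and both sides are then the default value.
    · rw [infOn_of_not_nonempty]
      · refine tendsto_const_nhds.congr' ?_
        filter_upwards [Ultrafilter.eventually_not.2 hne] with i hi
        exact (infOn_of_not_nonempty hi _ _).symm
      · rw [hX]
        rintro ⟨_, b, hb, -⟩
        exact hne (hb.mono fun i hi => ⟨_, hi⟩)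
  · by_cases hne : (X.obj M).Nonempty
    · have hne' : (X.obj N).Nonempty := ⟨_, X.map_mem M N ρ _ hne.some_mem⟩
      rw [infOn_of_nonempty hne, infOn_of_nonempty hne']
      refine le_csInf (hne.image _) ?_
      rintro _ ⟨b, hb, rfl⟩
      refine csInf_le ⟨-B, ?_⟩ ⟨_, X.map_mem M N ρ b hb, ψ.val_map_append ρ b a⟩
      rintro _ ⟨c, -, rfl⟩
      exact (abs_le.1 (hB N _)).1
    -- Monotonicity survives the passage from empty to non-empty because the default is the largest
    -- value of `ψ`.
    · rw [infOn_of_not_nonempty hne]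
      by_cases hne' : (X.obj N).Nonempty
      · rw [infOn_of_nonempty hne']
        refine (csInf_le ⟨-B, ?_⟩ (Set.mem_image_of_mem _ hne'.some_mem)).trans (ψ.val_le_maxValue N _)
        rintro _ ⟨c, -, rfl⟩
        exact (abs_le.1 (hB N _)).1
      · rw [infOn_of_not_nonempty hne']

end Quantification

/-! ### From zero sets to ultraproducts, and from quantification to distance -/

section Definable

variable {L : MetricLanguage.{u}} {T : Theory L} {n : ℕ} {S : Fin n → L.Sorts}

theorem TFunctor.exists_zeroset_of_dist (X : TFunctor T S)
    (hX : ∃ φ : TFormula T S, ∀ (M : Model T) (a : M.Tuple S), φ.val M a = distTo a (X.obj M))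
    {ε : ℝ} (hε : 0 < ε) :
    ∃ (φ : TFormula T S) (δ : ℝ), 0 < δ ∧ ∀ M : Model T, X.obj M ⊆ {a | φ.val M a = 0} ∧
      ∀ a : M.Tuple S, φ.val M a < δ → distTo a (X.obj M) ≤ ε := by
  obtain ⟨φ, hφ⟩ := hX
  refine ⟨φ, ε, hε, fun M => ⟨fun a ha => ?_, fun a ha => ?_⟩⟩
  · change φ.val M a = 0
    rw [hφ, distTo_of_nonempty a ⟨a, ha⟩, Metric.infDist_zero_of_mem ha]
  · rw [← hφ]
    exact ha.le

theorem TFunctor.exists_basic_zeroset (X : TFunctor T S) {ε : ℝ}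
    (hX : ∃ (φ : TFormula T S) (δ : ℝ), 0 < δ ∧ ∀ M : Model T, X.obj M ⊆ {a | φ.val M a = 0} ∧
      ∀ a : M.Tuple S, φ.val M a < δ → distTo a (X.obj M) ≤ ε) :
    ∃ (φ : BasicFormula L S) (δ : ℝ), 0 < δ ∧ ∀ M : Model T,
      X.obj M ⊆ {a | φ.val M.toMetricStructure a = 0} ∧
        ∀ a : M.Tuple S, φ.val M.toMetricStructure a < δ → distTo a (X.obj M) ≤ ε := by
  obtain ⟨φ, δ, hδ, hφ⟩ := hX
  obtain ⟨ψ, hψ⟩ := φ.exists_basic_near (ε := δ / 4) (by positivity)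
  -- On `X` the approximation `ψ` is at most `δ / 4`, so the truncation vanishes there; where it is
  -- below `δ / 4`, `φ` is below `3δ / 4`.
  obtain ⟨χ, hχ⟩ := BasicFormula.exists_conn (fun x _ => max (x - δ / 4) 0) (by fun_prop) ψ ψ
  refine ⟨χ, δ / 4, by positivity, fun M => ⟨fun a ha => ?_, fun a ha => (hφ M).2 a ?_⟩⟩
  · have h1 := hψ M a
    rw [show φ.val M a = 0 from (hφ M).1 ha, sub_zero] at h1
    change χ.val M.toMetricStructure a = 0
    rw [hχ]
    exact max_eq_right (sub_nonpos.2 (le_of_abs_le h1))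
  · have h1 := hψ M a
    rw [hχ] at ha
    have h2 := (le_max_left _ _).trans_lt ha
    rw [abs_le] at h1
    linarith

/-- A functor that is approximated by zero sets of basic formulas commutes with ultraproducts. -/
theorem TFunctor.obj_ultraproduct (hn : 0 < n) (X : TFunctor T S)
    (hX : ∀ ε : ℝ, 0 < ε → ∃ (φ : BasicFormula L S) (δ : ℝ), 0 < δ ∧ ∀ M : Model T,
      X.obj M ⊆ {a | φ.val M.toMetricStructure a = 0} ∧
        ∀ a : M.Tuple S, φ.val M.toMetricStructure a < δ → distTo a (X.obj M) ≤ ε)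
    (I : Type u) (U : Ultrafilter I) (M : I → Model T) :
    X.obj (Model.ultraproduct U M) =
      ultraSet U (fun i => (M i).toMetricStructure) fun i => X.obj (M i) := by
  have hB := iSup_bound_pos hn S
  have hB2 := half_lt_self hB
  apply Set.Subset.antisymm
  · intro x hx
    obtain ⟨a, rfl⟩ : ∃ a : ∀ i, (M i).Tuple S,
        ultraTuple U (fun i => (M i).toMetricStructure) a = x :=
      ⟨fun i j => ultraRep (x j) i, funext fun j => ultraMk_rep (x j)⟩
    have key : ∀ ε : ℝ, 0 < ε → ∀ᶠ i in (U : Filter I), distTo (a i) (X.obj (M i)) ≤ ε := by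
      intro ε hε
      obtain ⟨φ, δ, hδ, hφ⟩ := hX ε hε
      have h := tendsto_val_ultra U (fun i => (M i).toMetricStructure) a φ
      have h0 : φ.val (ultraproduct U fun i => (M i).toMetricStructure) (ultraTuple U _ a) = 0 :=
        (hφ (Model.ultraproduct U M)).1 hx
      rw [h0] at h
      exact (h.eventually (gt_mem_nhds hδ)).mono fun i hi => (hφ (M i)).2 _ hi
    -- A distance below the bound rules out the empty set; the bound is positive because there is at
    -- least one sort.
    have hne : ∀ᶠ i in (U : Filter I), (X.obj (M i)).Nonempty :=
      (key _ (half_pos hB)).mono fun i hi => nonempty_of_distTo_lt (hi.trans_lt hB2)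
    have hex : ∀ i, ∃ b : (M i).Tuple S, (X.obj (M i)).Nonempty →
        b ∈ X.obj (M i) ∧ dist (a i) b ≤ 2 * distTo (a i) (X.obj (M i)) := by
      intro i
      by_cases hi : (X.obj (M i)).Nonempty
      · rw [distTo_of_nonempty _ hi]
        -- The factor `2` leaves room for a near-minimiser only if the distance is positive;
        -- otherwise the point lies in `X` by closedness.
        rcases (Metric.infDist_nonneg (x := a i) (s := X.obj (M i))).eq_or_lt with h0 | h0
        · refine ⟨a i, fun _ => ⟨((X.isClosed' _).mem_iff_infDist_zero hi).2 h0.symm, ?_⟩⟩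
          rw [← h0, dist_self, mul_zero]
        · obtain ⟨b, hb, hlt⟩ := (Metric.infDist_lt_iff hi).1 (lt_two_mul_self h0)
          exact ⟨b, fun _ => ⟨hb, hlt.le⟩⟩
      · exact ⟨a i, fun h => absurd h hi⟩
    choose b hb using hex
    refine ⟨b, hne.mono fun i hi => (hb i hi).1, funext fun j => ?_⟩
    refine dist_le_zero.1 (le_of_forall_pos_le_add fun ε hε => ?_)
    rw [zero_add]
    refine le_of_tendsto (tendsto_dist_ultraMk U (fun i => (M i).toMetricStructure)
      (fun i => b i j) fun i => a i j) ?_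
    filter_upwards [hne, key (ε / 2) (half_pos hε)] with i hi hle
    have h1 := dist_le_pi_dist (a i) (b i) j
    have h2 := (hb i hi).2
    rw [dist_comm]
    linarith
  · rintro _ ⟨a, ha, rfl⟩
    let x : (Model.ultraproduct U M).Tuple S := ultraTuple U (fun i => (M i).toMetricStructure) a
    have key : ∀ ε : ℝ, 0 < ε → distTo x (X.obj (Model.ultraproduct U M)) ≤ ε := by
      intro ε hε
      obtain ⟨φ, δ, hδ, hφ⟩ := hX ε hε
      refine (hφ (Model.ultraproduct U M)).2 x ?_
      have h := tendsto_val_ultra U (fun i => (M i).toMetricStructure) a φ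
      have h0 := tendsto_nhds_unique h
        (tendsto_const_nhds.congr' (ha.mono fun i hi => ((hφ (M i)).1 hi).symm))
      exact h0.trans_lt hδ
    have hne := nonempty_of_distTo_lt ((key _ (half_pos hB)).trans_lt hB2)
    rw [distTo_of_nonempty _ hne] at key
    exact ((X.isClosed' _).mem_iff_infDist_zero hne).2
      (le_antisymm (le_of_forall_pos_le_add fun ε hε => by simpa using key ε hε)
        Metric.infDist_nonneg)

/-- If one can take infima and suprema over `X`, then emptiness of `X` is reflected by elementary
embeddings and passes to and from ultraproducts. -/
theorem TFunctor.nonempty_of_quantification (X : TFunctor T S)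
    (hinf : ∀ (m : ℕ) (Y : Fin m → L.Sorts) (ψ : TFormula T (Sum.elim S Y)),
      ∃ χ : TFormula T Y, ∀ (M : Model T) (a : M.Tuple Y),
        χ.val M a = infOn (X.obj M) (fun b => ψ.val M (b.append a)) ψ.maxValue)
    (hsup : ∀ (m : ℕ) (Y : Fin m → L.Sorts) (ψ : TFormula T (Sum.elim S Y)),
      ∃ χ : TFormula T Y, ∀ (M : Model T) (a : M.Tuple Y),
        χ.val M a = supOn (X.obj M) (fun b => ψ.val M (b.append a)) ψ.minValue) :
    (∀ M N : Model T, ElementaryEmbedding M.toMetricStructure N.toMetricStructure →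
      (X.obj N).Nonempty → (X.obj M).Nonempty) ∧
    ∀ (I : Type u) (U : Ultrafilter I) (M : I → Model T),
      (X.obj (Model.ultraproduct U M)).Nonempty ↔
        ∀ᶠ i in (U : Filter I), (X.obj (M i)).Nonempty := by
  -- The gap argument needs a formula with two different values; without one, all formulas are
  -- constant across all models.
  by_cases h : ∃ (m : ℕ) (Y : Fin m → L.Sorts) (ψ : TFormula T (Sum.elim S Y)) (M N : Model T)
      (a : M.Tuple (Sum.elim S Y)) (b : N.Tuple (Sum.elim S Y)), ψ.val M a < ψ.val N b
  · obtain ⟨m, Y, ψ, M₀, N₀, a₀, b₀, hlt⟩ := h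
    have hδ : ψ.minValue < ψ.maxValue :=
      (ψ.minValue_le_val M₀ a₀).trans_lt (hlt.trans_le (ψ.val_le_maxValue N₀ b₀))
    obtain ⟨χ, hχ⟩ := hinf m Y ψ
    obtain ⟨χ', hχ'⟩ := hsup m Y ψ
    obtain ⟨B, hB⟩ := ψ.exists_bound
    have hle : ∀ (M : Model T) (y : M.Tuple Y), (X.obj M).Nonempty → χ.val M y ≤ χ'.val M y := by
      intro M y hne
      rw [hχ, hχ', infOn_of_nonempty hne, supOn_of_nonempty hne]
      refine Real.sInf_le_sSup _ ⟨-B, ?_⟩ ⟨B, ?_⟩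
      · rintro _ ⟨b, -, rfl⟩
        exact (abs_le.1 (hB M _)).1
      · rintro _ ⟨b, -, rfl⟩
        exact (abs_le.1 (hB M _)).2
    have hgap : ∀ (M : Model T) (y : M.Tuple Y), ¬(X.obj M).Nonempty →
        χ.val M y = ψ.maxValue ∧ χ'.val M y = ψ.minValue := by
      intro M y hne
      rw [hχ, hχ', infOn_of_not_nonempty hne, supOn_of_not_nonempty hne]
      exact ⟨rfl, rfl⟩
    have hiff : ∀ (M : Model T) (y : M.Tuple Y), χ.val M y ≤ χ'.val M y → (X.obj M).Nonempty := by
      intro M y hy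
      by_contra hne
      obtain ⟨h1, h2⟩ := hgap M y hne
      linarith
    refine ⟨fun M N ρ hN => ?_, fun I U M => ?_⟩
    · have y : M.Tuple Y := Classical.arbitrary _
      refine hiff M y ?_
      rw [← χ.val_map ρ, ← χ'.val_map ρ]
      exact hle N _ hN
    · have y : ∀ i, (M i).Tuple Y := fun i => Classical.arbitrary _
      have h1 := χ.tendsto_val_ultra U M y
      have h2 := χ'.tendsto_val_ultra U M y
      refine ⟨fun hne => ?_, fun hne => ?_⟩
      · have h3 := (h1.sub h2).eventually (gt_mem_nhds
          ((sub_nonpos.2 (hle _ _ hne)).trans_lt (sub_pos.2 hδ)))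
        refine h3.mono fun i hi => ?_
        by_contra hi'
        obtain ⟨h4, h5⟩ := hgap (M i) (y i) hi'
        rw [h4, h5] at hi
        exact lt_irrefl _ hi
      · exact hiff _ _ (le_of_tendsto_of_tendsto h1 h2 (hne.mono fun i hi => hle _ _ hi))
  · push Not at h
    have hval : ∀ {m : ℕ} (Y : Fin m → L.Sorts) (φ : BasicFormula L Y) (M N : Model T)
        (a : M.Tuple Y) (b : N.Tuple Y),
        φ.val N.toMetricStructure b ≤ φ.val M.toMetricStructure a := by
      intro m Y φ M N a b
      -- Adding dummy variables of sort `S` brings `φ` into the range of `h`.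
      let ψ : BasicFormulaMod T (Sum.elim S Y) := φ.relabel (Γ := Sum.elim S Y) Sum.inr
      have hψ : ∀ (M : Model T) (c : M.Tuple S) (a : M.Tuple Y),
          TFormula.val (ψ : TFormula T (Sum.elim S Y)) M (c.append a) =
            φ.val M.toMetricStructure a := fun M c a =>
        (TFormula.val_coe ψ M _).trans
          (BasicFormula.val_relabel (Γ := Sum.elim S Y) Sum.inr φ M.toMetricStructure (c.append a))
      have := h m Y ψ M N (MetricStructure.Tuple.append (Γ := S) (Classical.arbitrary _) a)
        (MetricStructure.Tuple.append (Γ := S) (Classical.arbitrary _) b)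
      rwa [hψ, hψ] at this
    -- Since every formula has a single value, any map is elementary, even a constant one on each
    -- sort. So `X` is non-empty in all models or in none.
    have hmap : ∀ M N : Model T, (X.obj M).Nonempty → (X.obj N).Nonempty := fun M N hM =>
      ⟨_, X.map_mem M N (.ofVal (fun _ _ => Classical.arbitrary _) fun Y φ a =>
        le_antisymm (hval Y φ M N _ _) (hval Y φ N M _ _)) _ hM.some_mem⟩
    exact ⟨fun M N _ => hmap N M, fun I U M => ⟨fun hne => .of_forall fun i => hmap _ _ hne,
      fun hne => hne.exists.elim fun i hi => hmap _ _ hi⟩⟩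

/-- If one can take infima and suprema over `X`, then the distance to `X` is a `T`-formula. -/
theorem TFunctor.exists_dist_of_quantification (X : TFunctor T S)
    (hinf : ∀ (m : ℕ) (Y : Fin m → L.Sorts) (ψ : TFormula T (Sum.elim S Y)),
      ∃ χ : TFormula T Y, ∀ (M : Model T) (a : M.Tuple Y),
        χ.val M a = infOn (X.obj M) (fun b => ψ.val M (b.append a)) ψ.maxValue)
    (hsup : ∀ (m : ℕ) (Y : Fin m → L.Sorts) (ψ : TFormula T (Sum.elim S Y)),
      ∃ χ : TFormula T Y, ∀ (M : Model T) (a : M.Tuple Y),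
        χ.val M a = supOn (X.obj M) (fun b => ψ.val M (b.append a)) ψ.minValue) :
    ∃ φ : TFormula T S, ∀ (M : Model T) (a : M.Tuple S), φ.val M a = distTo a (X.obj M) := by
  obtain ⟨hemb, hult⟩ := X.nonempty_of_quantification hinf hsup
  obtain ⟨δ, hδ⟩ := BasicFormula.exists_dist S
  let δ' : BasicFormulaMod T (Sum.elim S S) := δ
  -- This infimum is the distance only where `X` is non-empty; on the empty set the two default
  -- values may differ.
  obtain ⟨χ, hχ⟩ := hinf n S δ'
  have hχd : ∀ (M : Model T) (a : M.Tuple S), (X.obj M).Nonempty →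
      distTo a (X.obj M) = χ.val M a := by
    intro M a hne
    have hval : ∀ b : M.Tuple S,
        TFormula.val (δ' : TFormula T (Sum.elim S S)) M (b.append a) = dist a b := fun b =>
      ((TFormula.val_coe δ' M _).trans (hδ M.toMetricStructure b a)).trans (dist_comm b a)
    rw [hχ, infOn_of_nonempty hne, distTo_of_nonempty a hne, Metric.infDist_eq_iInf, sInf_image']
    simp only [hval]
  refine TFormula.exists_of_ultra _ (fun I U M a => ?_) fun M N ρ a => ?_
  · let x : (Model.ultraproduct U M).Tuple S := ultraTuple U (fun i => (M i).toMetricStructure) a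
    change Tendsto _ _ (𝓝 (distTo x _))
    by_cases hne : (X.obj (Model.ultraproduct U M)).Nonempty
    · rw [hχd _ _ hne]
      exact (χ.tendsto_val_ultra U M a).congr'
        (((hult I U M).1 hne).mono fun i hi => (hχd _ _ hi).symm)
    · rw [distTo_of_not_nonempty _ hne]
      refine tendsto_const_nhds.congr' ?_
      filter_upwards [Ultrafilter.eventually_not.2 (mt (hult I U M).2 hne)] with i hi
      exact (distTo_of_not_nonempty _ hi).symm
  · by_cases hne : (X.obj M).Nonempty
    · rw [hχd _ _ hne, hχd _ _ ⟨_, X.map_mem M N ρ _ hne.some_mem⟩, χ.val_map ρ]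
    · rw [distTo_of_not_nonempty _ hne, distTo_of_not_nonempty _ (mt (hemb M N ρ) hne)]

end Definable

-- The equivalence

end ContinuousLogic

theorem mainTheorem3 {L : MetricLanguage.{u}} (T : Theory L) {n : ℕ} (hn : 0 < n)
    (S : Fin n → L.Sorts) (X : TFunctor T S) :
    List.TFAE [
      -- the distance to `X(M)` is given by a `T`-formula
      ∃ φ : TFormula T S, ∀ (M : Model T) (a : M.Tuple S), φ.val M a = distTo a (X.obj M),
      -- one can quantify (with `inf`) over `X` by `T`-formulas
      ∀ (m : ℕ) (Y : Fin m → L.Sorts) (ψ : TFormula T (Sum.elim S Y)),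
        ∃ χ : TFormula T Y, ∀ (M : Model T) (a : M.Tuple Y),
          χ.val M a = infOn (X.obj M) (fun b => ψ.val M (b.append a)) ψ.maxValue,
      -- one can quantify (with `sup`) over `X` by `T`-formulas
      ∀ (m : ℕ) (Y : Fin m → L.Sorts) (ψ : TFormula T (Sum.elim S Y)),
        ∃ χ : TFormula T Y, ∀ (M : Model T) (a : M.Tuple Y),
          χ.val M a = supOn (X.obj M) (fun b => ψ.val M (b.append a)) ψ.minValue,
      -- approximation by zero sets of `T`-formulas
      ∀ ε : ℝ, 0 < ε → ∃ (φ : TFormula T S) (δ : ℝ), 0 < δ ∧ ∀ M : Model T,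
        X.obj M ⊆ {a | φ.val M a = 0} ∧
          ∀ a : M.Tuple S, φ.val M a < δ → distTo a (X.obj M) ≤ ε,
      -- approximation by zero sets of basic formulas
      ∀ ε : ℝ, 0 < ε → ∃ (φ : BasicFormula L S) (δ : ℝ), 0 < δ ∧ ∀ M : Model T,
        X.obj M ⊆ {a | φ.val M.toMetricStructure a = 0} ∧
          ∀ a : M.Tuple S, φ.val M.toMetricStructure a < δ → distTo a (X.obj M) ≤ ε,
      -- `X` commutes with ultraproducts
      ∀ (I : Type u) (U : Ultrafilter I) (M : I → Model T),
        X.obj (Model.ultraproduct U M) =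
          ultraSet U (fun i => (M i).toMetricStructure) fun i => X.obj (M i)] := by
  tfae_have 1 → 4 := fun h ε hε => X.exists_zeroset_of_dist h hε
  tfae_have 4 → 5 := fun h ε hε => X.exists_basic_zeroset (h ε hε)
  tfae_have 5 → 6 := X.obj_ultraproduct hn
  tfae_have 6 → 2 := fun h m Y ψ => X.exists_infOn h ψ
  -- A supremum is minus the infimum of `-ψ`. The conventions for the empty set correspond, since
  -- the maximum of `-ψ` is minus the minimum of `ψ`.
  tfae_have 2 → 3 := by
    intro h m Y ψ
    obtain ⟨ψ', hψ'⟩ := ψ.exists_neg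
    obtain ⟨χ, hχ⟩ := h m Y ψ'
    obtain ⟨χ', hχ'⟩ := χ.exists_neg
    refine ⟨χ', fun M a => ?_⟩
    simp only [hχ', hχ, hψ', TFormula.maxValue_of_neg hψ', infOn_neg, neg_neg]
  tfae_have 3 → 2 := by
    intro h m Y ψ
    obtain ⟨ψ', hψ'⟩ := ψ.exists_neg
    obtain ⟨χ, hχ⟩ := h m Y ψ'
    obtain ⟨χ', hχ'⟩ := χ.exists_neg
    refine ⟨χ', fun M a => ?_⟩
    simp only [hχ', hχ, hψ', TFormula.minValue_of_neg hψ', supOn_neg, neg_neg]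
  -- Infima and suprema are needed together, since detecting emptiness compares the two.
  tfae_have 2 → 1 := fun h => X.exists_dist_of_quantification h (tfae_2_to_3 h)
  tfae_finish
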